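/- Let $K$ be an imaginary quadratic field with ring of integers $\mathcal{O}_K$ and discriminant $D_K$, let $\ell$ be a prime number, and let $c\geq 1$ be an integer coprime to $\ell$. For $d\geq 0$ let $\mathcal{O}_d=\mathbf{Z}+c\ell^d\mathcal{O}_K$ be the order of conductor $c\ell^d$ in $K$, let $\operatorname{Cl}(\mathcal{O}_d)$ be its ideal class group (invertible fractional ideals modulo principal ones), and let $S_d=\operatorname{Cl}(\mathcal{O}_d)[\ell^\infty]$ be its Sylow $\ell$-subgroup. For $d\leq d'$ let $S_{d'}\to S_d$ be the restriction of the natural homomorphism $\operatorname{Cl}(\mathcal{O}_{d'})\to\operatorname{Cl}(\mathcal{O}_d)$, $[\mathfrak{a}]\mapsto[\mathfrak{a}\mathcal{O}_d]$. Let $\kappa_d$ be the kernel of $S_d\to S_0$, and let $\pi'_d\colon\kappa_{d+1}\to\kappa_d$ be the restriction of $S_{d+1}\to S_d$. Write $\operatorname{can}$ for the canonical surjections $\mathbf{Z}/\ell^{n+1}\mathbf{Z}\to\mathbf{Z}/\ell^n\mathbf{Z}$. Call $(D_K,\ell,c)$ exceptional if it is $(-4,2,1)$ or $(-3,3,1)$.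 For $d=0$ we have $\kappa_0=1$, and $\pi'_0\colon\kappa_1\to\kappa_0$ is trivial. In each of the following cases there is a family of isomorphisms from the groups $\kappa_d$ to the stated groups, for all $d$ in the stated range, which identifies the homomorphisms $\pi'_d\colon\kappa_{d+1}\to\kappa_d$ with the stated maps. (a) If $\ell\geq 3$ is split or inert in $\mathcal{O}_K$: for $d\geq 1$, $\kappa_d\cong\mathbf{Z}/\ell^{d-1}\mathbf{Z}$ and $\pi'_d$ is $\operatorname{can}$. (b) If $\ell$ is ramified in $\mathcal{O}_K$ and either $\ell=2$ and $D_K\equiv 8\pmod{16}$, or $\ell=3$ and $D_K\equiv 3\pmod 9$, or $\ell\geq 5$: for $d\geq 1$, $\kappa_d\cong\mathbf{Z}/\ell^d\mathbf{Z}$ and $\pi'_d$ is $\operatorname{can}$. (c) If $\ell$ is ramified in $\mathcal{O}_K$ and either $\ell=2$ and $D_K\equiv 12\pmod{16}$, or $\ell=3$ and $D_K\equiv 6\pmod 9$, and $(D_K,\ell,c)$ is not exceptional: for $d\geq 1$, $\kappa_d\cong\mathbf{Z}/\ell^{d-1}\mathbf{Z}\times\mathbf{Z}/\ell\mathbf{Z}$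 and $\pi'_d$ is $\operatorname{can}\times\operatorname{id}$. (d) If $\ell=2$ is split or inert in $\mathcal{O}_K$: $\kappa_1=1$, and for $d\geq 2$, $\kappa_d\cong\mathbf{Z}/2^{d-2}\mathbf{Z}\times\mathbf{Z}/2\mathbf{Z}$ and $\pi'_d$ is $\operatorname{can}\times\operatorname{id}$. Moreover, $\ker\pi'_0\cong\mathbf{Z}/\ell\mathbf{Z}$ if $\ell$ is ramified in $\mathcal{O}_K$ and $(D_K,\ell,c)$ is not exceptional, $\ker\pi'_0=1$ if $\ell$ is not ramified in $\mathcal{O}_K$, and $\ker\pi'_d\cong\mathbf{Z}/\ell\mathbf{Z}$ for all $d\geq 1$. -/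

import Mathlib

open NumberField

noncomputable section

/-- The order `ℤ + f 𝓞_K` of conductor `f` in a quadratic field `K`. -/
def quadOrder (K : Type*) [Field K] (f : ℕ) : Subring (𝓞 K) where
  carrier := {x | ∃ (a : ℤ) (y : 𝓞 K), x = (a : 𝓞 K) + (f : 𝓞 K) * y}
  zero_mem' := ⟨0, 0, by simp⟩
  one_mem' := ⟨1, 0, by simp⟩
  add_mem' := by
    rintro _ _ ⟨a, y, rfl⟩ ⟨b, z, rfl⟩
    exact ⟨a + b, y + z, by push_cast; ring⟩
  neg_mem' := by
    rintro _ ⟨a, y, rfl⟩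
    exact ⟨-a, -y, by push_cast; ring⟩
  mul_mem' := by
    rintro _ _ ⟨a, y, rfl⟩ ⟨b, z, rfl⟩
    exact ⟨a * b, a * z + b * y + f * (y * z), by push_cast; ring⟩

theorem quadOrder_le (K : Type*) [Field K] {f g : ℕ} (h : f ∣ g) :
    quadOrder K g ≤ quadOrder K f := by
  rintro _ ⟨a, y, rfl⟩
  obtain ⟨m, rfl⟩ := h
  exact ⟨a, m * y, by push_cast; ring⟩

/-- For subrings `A ≤ B` of a domain, the natural homomorphism `Cl(A) → Cl(B)`
sending the class of an invertible fractional ideal `I` to the class of `I B`. -/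
def subringClassMap {R : Type*} [CommRing R] [IsDomain R] {A B : Subring R} (h : A ≤ B) :
    ClassGroup A →* ClassGroup B :=
  letI : Algebra A B := (Subring.inclusion h).toAlgebra
  haveI : Module.IsTorsionFree A B :=
    Module.isTorsionFree_iff_algebraMap_injective.mpr (Subring.inclusion_injective h)
  ClassGroup.extendedHom A B

theorem subringClassMap_comp {R : Type*} [CommRing R] [IsDomain R] {A B C : Subring R}
    (h : A ≤ B) (h' : B ≤ C) (x : ClassGroup A) :
    subringClassMap h' (subringClassMap h x) = subringClassMap (h.trans h') x := by
  induction x using QuotientGroup.induction_on with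
  | H I =>
    apply congrArg (QuotientGroup.mk
      (s := (toPrincipalIdeal C (FractionRing C)).range))
    apply Units.ext
    exact FractionalIdeal.extended_extended (L := FractionRing B) (W := FractionRing C) _ _ _

/-- `S_d`: the elements of `ℓ`-power order in `Cl(𝓞_d)`, where `𝓞_d` is the order of
conductor `c ℓ^d` in `K`. -/
def sylowCl (K : Type*) [Field K] (ℓ c d : ℕ) : Subgroup (ClassGroup (quadOrder K (c * ℓ ^ d))) :=
  CommGroup.primaryComponent _ ℓ

/-- The natural homomorphism `S_e → S_d` for `d ≤ e`: the restriction of the natural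
homomorphism `Cl(𝓞_e) → Cl(𝓞_d)`. -/
def sylowMap (K : Type*) [Field K] (ℓ c : ℕ) {d e : ℕ} (h : d ≤ e) :
    sylowCl K ℓ c e →* sylowCl K ℓ c d :=
  ((subringClassMap (quadOrder_le K (mul_dvd_mul_left c (pow_dvd_pow ℓ h)))).comp
    (sylowCl K ℓ c e).subtype).codRestrict (sylowCl K ℓ c d) (by
      rintro ⟨x, k, hk⟩
      exact ⟨k, by
        change (subringClassMap _ x) ^ _ = 1
        rw [← map_pow, hk, map_one]⟩)

theorem sylowMap_comp (K : Type*) [Field K] (ℓ c : ℕ) {d e f : ℕ} (h : d ≤ e) (h' : e ≤ f)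
    (x : sylowCl K ℓ c f) :
    sylowMap K ℓ c h (sylowMap K ℓ c h' x) = sylowMap K ℓ c (h.trans h') x :=
  Subtype.ext (subringClassMap_comp _ _ x.1)

/-- `κ_d`: the kernel of `S_d → S_0`. -/
def kappa (K : Type*) [Field K] (ℓ c d : ℕ) : Subgroup (sylowCl K ℓ c d) :=
  (sylowMap K ℓ c (Nat.zero_le d)).ker

/-- `π'_d : κ_{d+1} → κ_d`: the restriction of the natural homomorphism `S_{d+1} → S_d`. -/
def kappaMap (K : Type*) [Field K] (ℓ c d : ℕ) : kappa K ℓ c (d + 1) →* kappa K ℓ c d :=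
  ((sylowMap K ℓ c (Nat.le_succ d)).comp (kappa K ℓ c (d + 1)).subtype).codRestrict
    (kappa K ℓ c d) (by
      rintro ⟨x, hx⟩
      exact (sylowMap_comp K ℓ c (Nat.zero_le d) (Nat.le_succ d) x).trans hx)

/-- `ℓ` splits in `K`: `ℓ 𝓞_K` is the product of two distinct prime ideals. -/
def SplitIn (K : Type*) [Field K] (ℓ : ℕ) : Prop :=
  ∃ P Q : Ideal (𝓞 K), P.IsPrime ∧ Q.IsPrime ∧ P ≠ Q ∧ Ideal.span {(ℓ : 𝓞 K)} = P * Q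

/-- `ℓ` is inert in `K`: `ℓ 𝓞_K` is a prime ideal. -/
def InertIn (K : Type*) [Field K] (ℓ : ℕ) : Prop :=
  (Ideal.span {(ℓ : 𝓞 K)}).IsPrime

/-- `ℓ` is ramified in `K`: `ℓ 𝓞_K` is the square of a prime ideal. -/
def RamifiedIn (K : Type*) [Field K] (ℓ : ℕ) : Prop :=
  ∃ P : Ideal (𝓞 K), P.IsPrime ∧ Ideal.span {(ℓ : 𝓞 K)} = P ^ 2

/-- The canonical surjection `ℤ/ℓ^(n+1) → ℤ/ℓ^n`. -/
def canProj (ℓ n : ℕ) : ZMod (ℓ ^ (n + 1)) →+ ZMod (ℓ ^ n) :=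
  (ZMod.castHom (pow_dvd_pow ℓ (Nat.le_succ n)) (ZMod (ℓ ^ n))).toAddMonoidHom

end

noncomputable section

open scoped nonZeroDivisors

/-! A class in the kernel of `Cl(𝓞_d) → Cl(𝓞_0)` is that of a module `𝓞_d u + ℓ^d 𝓞_0` with `u ∈
𝓞_0` prime to `ℓ` (`exists_phi_of_classMap_eq_one`). It is trivial exactly when `u` is a unit of
`𝓞_0` times an element of `𝓞_d = ℤ + ℓ^d 𝓞_0` (`phi_eq_one_iff`). So `κ_d` is the `ℓ`-part of
`(𝓞_0/ℓ^d)ˣ` modulo the images of integers and units, and the problem becomes explicit arithmetic in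
`𝓞_0`.

Write `𝓞_0 = ℤ ⊕ ℤη` with `η² = Tη - N` and `Δ = T² - 4N = c² D_K`. The level of `a + bη` is the
`ℓ`-adic valuation of `b`. From level 1 on (level 2 if `ℓ = 2` and `T` is odd), an `ℓ`-th power
raises the level of an element prime to `ℓ` by exactly one (`level_pow_prime`). A unit of positive
level is `±1`, so levels of elements determine the orders of their classes (`orderOf_kappaOf`).

Sizes: for `d ≥ 1` the map `κ_{d+1} → κ_d` is onto, with kernel of order `ℓ` generated by `1 + ℓ^d
η` (`card_ker_kappaMap`), so only `κ_1` remains. If `ℓ ∤ Δ`, the square of Frobenius is the identity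
modulo `ℓ`, and `κ_1` is trivial. If `ℓ ∣ Δ`, some `η - r` is nilpotent modulo `ℓ`, and `1 + (η -
r)` generates a `κ_1` of order `ℓ`, provided that the units are `±1`; this is where the exceptional
triples drop out.

Structure: compatible elements of the right orders are exhibited. The element `1 + ℓη` (or `1 + 4η`)
gives the large cyclic factor. In the cyclic ramified case, `1 + √Δ` (or `1 + √(Δ/4)` for `ℓ = 2`)
has `ℓ`-th power of level exactly 1. The extra factor `ℤ/ℓ` comes from `√Δ` or `√(Δ/4)` for `ℓ = 2`,
and for `ℓ = 3` from approximations to `1 + √-3` in the 3-adic completion, whose cube is rational. A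
count finishes the proof (`exists_equiv_tower`, `exists_equiv_tower_prod`). -/

/-! ### Extension of ideal classes, computed in any field of fractions. -/

theorem FractionalIdeal.canonicalEquiv_eq_extended {A K L : Type*} [CommRing A] [IsDomain A]
    [Field K] [Field L] [Algebra A K] [IsFractionRing A K] [Algebra A L] [IsFractionRing A L]
    (I : FractionalIdeal A⁰ K) :
    FractionalIdeal.canonicalEquiv A⁰ K L I =
      I.extended L (f := RingHom.id A) (M := A⁰) (N := A⁰) (le_of_eq rfl) := by
  apply FractionalIdeal.coeToSubmodule_injective
  beta_reduce
  rw [FractionalIdeal.coe_extended_eq_span]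
  apply le_antisymm
  · intro x hx
    obtain ⟨y, hy, rfl⟩ := (FractionalIdeal.mem_canonicalEquiv_apply _ _ _).1 hx
    exact Submodule.subset_span ⟨y, hy, rfl⟩
  · rw [Submodule.span_le]
    rintro _ ⟨y, hy, rfl⟩
    exact (FractionalIdeal.mem_canonicalEquiv_apply _ _ _).2 ⟨y, hy, rfl⟩

/-- The extension of class groups may be computed in any field of fractions. -/
theorem ClassGroup.extendedHom_mk_field {A B K L : Type*} [CommRing A] [IsDomain A] [CommRing B]
    [IsDomain B] [Algebra A B] [Module.IsTorsionFree A B] [Field K] [Field L] [Algebra A K]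
    [Algebra B L] [IsFractionRing A K] [IsFractionRing B L]
    (I : (FractionalIdeal A⁰ K)ˣ) :
    ClassGroup.extendedHom A B (ClassGroup.mk K I) =
      ClassGroup.mk L (Units.map (FractionalIdeal.extendedHom L B).toMonoidHom I) := by
  rw [← ClassGroup.mk_canonicalEquiv (K := K) (FractionRing A), ClassGroup.extendedHom_mk,
    ← ClassGroup.mk_canonicalEquiv (K := L) (FractionRing B)]
  congr 1
  apply Units.ext
  change (FractionalIdeal.canonicalEquiv A⁰ K (FractionRing A) I.1).extended _ _ =
    FractionalIdeal.canonicalEquiv B⁰ L (FractionRing B) (I.1.extended L _)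
  rw [FractionalIdeal.canonicalEquiv_eq_extended, FractionalIdeal.canonicalEquiv_eq_extended,
    FractionalIdeal.extended_extended, FractionalIdeal.extended_extended]

/-! ### The invertible modules `A u + N C` and the kernel of `Cl(A) → Cl(C)`. -/

section Twist

variable {A C K : Type*} [CommRing A] [CommRing C] [Algebra A C]
  [Field K] [Algebra A K] [Algebra C K] [IsScalarTower A C K]

/-- The `A`-submodule `A u + N C` of the fraction field of `C`. -/
def twistModule (A K : Type*) {C : Type*} [CommRing A] [CommRing C] [Algebra A C]
    [Field K] [Algebra A K] [Algebra C K] [IsScalarTower A C K] (N u : C) : Submodule A K where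
  carrier := {x | ∃ (a : A) (z : C), algebraMap C K (algebraMap A C a * u + N * z) = x}
  zero_mem' := ⟨0, 0, by simp⟩
  add_mem' := by
    rintro _ _ ⟨a, z, rfl⟩ ⟨a', z', rfl⟩
    exact ⟨a + a', z + z', by rw [← map_add, map_add (algebraMap A C)]; ring_nf⟩
  smul_mem' := by
    rintro r _ ⟨a, z, rfl⟩
    refine ⟨r * a, algebraMap A C r * z, ?_⟩
    rw [Algebra.smul_def, IsScalarTower.algebraMap_apply A C K, ← map_mul, map_mul (algebraMap A C)]
    ring_nf

theorem twistModule_mul (N u v : C) (hv : IsCoprime v N) :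
    twistModule A K N u * twistModule A K N v = twistModule A K N (u * v) := by
  apply le_antisymm
  · rw [Submodule.mul_le]
    rintro _ ⟨a, z, rfl⟩ _ ⟨a', z', rfl⟩
    refine ⟨a * a', algebraMap A C a * u * z' + algebraMap A C a' * v * z + N * z * z', ?_⟩
    rw [← map_mul, map_mul (algebraMap A C)]
    ring_nf
  · rintro _ ⟨a, z, rfl⟩
    obtain ⟨w, k, h⟩ := hv
    -- With `w v + k N = 1`, the term `N z` splits as `(N z w) v + (N z)(N k)`, both summands lying
    -- in the product.
    have e : algebraMap C K (algebraMap A C a * (u * v) + N * z) =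
        algebraMap C K (algebraMap A C a * u + N * 0) * algebraMap C K (algebraMap A C 1 * v + N * 0)
        + (algebraMap C K (algebraMap A C 0 * u + N * (z * w)) *
            algebraMap C K (algebraMap A C 1 * v + N * 0) +
          algebraMap C K (algebraMap A C 0 * u + N * z) *
            algebraMap C K (algebraMap A C 0 * v + N * k)) := by
      simp only [← map_mul, ← map_add, map_one, map_zero]
      congr 1
      linear_combination (-N * z) * h
    rw [e]
    exact add_mem (Submodule.mul_mem_mul ⟨_, _, rfl⟩ ⟨_, _, rfl⟩)
      (add_mem (Submodule.mul_mem_mul ⟨_, _, rfl⟩ ⟨_, _, rfl⟩)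
        (Submodule.mul_mem_mul ⟨_, _, rfl⟩ ⟨_, _, rfl⟩))

theorem twistModule_congr {N u v : C} (h : N ∣ u - v) :
    twistModule A K N u = twistModule A K N v := by
  have key : ∀ u v : C, N ∣ u - v → twistModule A K N u ≤ twistModule A K N v := by
    rintro u v ⟨k, h⟩ _ ⟨a, z, rfl⟩
    refine ⟨a, algebraMap A C a * k + z, ?_⟩
    congr 1
    linear_combination (-algebraMap A C a) * h
  exact le_antisymm (key u v h) (key v u (by rw [← neg_sub]; exact (dvd_neg).2 h))

theorem twistModule_one {N : C} (hN : ∀ z : C, N * z ∈ (algebraMap A C).range) :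
    twistModule A K N 1 = 1 := by
  apply le_antisymm
  · rintro _ ⟨a, z, rfl⟩
    obtain ⟨b, hb⟩ := hN z
    rw [Submodule.mem_one]
    exact ⟨a + b, by rw [IsScalarTower.algebraMap_apply A C K, map_add, hb, mul_one]⟩
  · rw [Submodule.one_le]
    exact ⟨1, 0, by simp⟩

theorem exists_isCoprime_inverse {N u : C} (hu : IsCoprime u N) :
    ∃ w, IsCoprime w N ∧ N ∣ u * w - 1 := by
  obtain ⟨w, k, h⟩ := hu
  exact ⟨w, ⟨u, k, by rw [← h]; ring⟩, -k, by linear_combination h⟩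

theorem exists_unit_of_span_eq_one [IsFractionRing C K] {x : K}
    (h : Submodule.span C {x} = (1 : Submodule C K)) : ∃ e : Cˣ, algebraMap C K e = x := by
  have hx : x ∈ (1 : Submodule C K) := h ▸ Submodule.mem_span_singleton_self x
  obtain ⟨y, rfl⟩ := Submodule.mem_one.1 hx
  have h1 : (1 : K) ∈ Submodule.span C {algebraMap C K y} := h ▸ (Submodule.one_le.1 le_rfl)
  obtain ⟨z, hz⟩ := Submodule.mem_span_singleton.1 h1
  have : z * y = 1 := by
    apply IsFractionRing.injective C K
    rw [map_mul, map_one, ← hz, Algebra.smul_def]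
  exact ⟨⟨y, z, by rw [mul_comm, this], this⟩, rfl⟩

theorem span_twistModule {N u : C} (hu : IsCoprime u N) :
    Submodule.span C (twistModule A K N u : Set K) = 1 := by
  apply le_antisymm
  · rw [Submodule.span_le]
    rintro _ ⟨a, z, rfl⟩
    exact Submodule.mem_one.2 ⟨_, rfl⟩
  · rw [Submodule.one_le]
    obtain ⟨w, k, h⟩ := hu
    have e : (1 : K) = w • algebraMap C K (algebraMap A C 1 * u + N * 0) +
        (1 : C) • algebraMap C K (algebraMap A C 0 * u + N * k) := by
      rw [Algebra.smul_def, Algebra.smul_def, ← map_mul, ← map_mul, ← map_add,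
        ← map_one (algebraMap C K)]
      congr 1
      rw [map_one, map_zero]
      linear_combination -h
    rw [e]
    exact add_mem (Submodule.smul_mem _ _ (Submodule.subset_span ⟨_, _, rfl⟩))
      (Submodule.smul_mem _ _ (Submodule.subset_span ⟨_, _, rfl⟩))

variable [IsFractionRing A K]

/-- The inverse is `A w + N C` with `u w ≡ 1` modulo `N`: the product is `A + N C`, which is `A`
because `N C ⊆ A`. -/
theorem exists_units_twistModule {N u : C} (hN : ∀ z : C, N * z ∈ (algebraMap A C).range)
    (hu : IsCoprime u N) :
    ∃ I : (FractionalIdeal A⁰ K)ˣ, (I.1 : Submodule A K) = twistModule A K N u := by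
  obtain ⟨w, hw, h⟩ := exists_isCoprime_inverse hu
  have h1 : twistModule A K N u * twistModule A K N w = 1 := by
    rw [twistModule_mul _ _ _ hw, twistModule_congr h, twistModule_one hN]
  exact ⟨FractionalIdeal.unitsMulEquivSubmodule.symm
    ⟨twistModule A K N u, twistModule A K N w, h1, by rw [mul_comm, h1]⟩, rfl⟩

variable [IsDomain A]

/-- The class of the invertible module `A u + N C`, for `u` prime to `N`. -/
def twistClass (A K : Type*) {C : Type*} [CommRing A] [IsDomain A] [CommRing C] [Algebra A C]
    [Field K] [Algebra A K] [Algebra C K] [IsScalarTower A C K] [IsFractionRing A K]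
    {N : C} (hN : ∀ z : C, N * z ∈ (algebraMap A C).range) (u : C) (hu : IsCoprime u N) :
    ClassGroup A :=
  ClassGroup.mk K (exists_units_twistModule (K := K) hN hu).choose

theorem twistClass_eq_mk {N u : C} (hN : ∀ z : C, N * z ∈ (algebraMap A C).range)
    (hu : IsCoprime u N) (I : (FractionalIdeal A⁰ K)ˣ)
    (hI : (I.1 : Submodule A K) = twistModule A K N u) :
    twistClass A K hN u hu = ClassGroup.mk K I := by
  unfold twistClass
  congr 1
  apply Units.ext
  apply FractionalIdeal.coeToSubmodule_injective
  exact ((exists_units_twistModule (K := K) hN hu).choose_spec).trans hI.symm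

theorem twistClass_mul {N u v : C} (hN : ∀ z : C, N * z ∈ (algebraMap A C).range)
    (hu : IsCoprime u N) (hv : IsCoprime v N) :
    twistClass A K hN (u * v) (hu.mul_left hv) =
      twistClass A K hN u hu * twistClass A K hN v hv := by
  obtain ⟨I, hI⟩ := exists_units_twistModule (K := K) hN hu
  obtain ⟨J, hJ⟩ := exists_units_twistModule (K := K) hN hv
  rw [twistClass_eq_mk hN hu I hI, twistClass_eq_mk hN hv J hJ, ← map_mul]
  apply twistClass_eq_mk
  rw [Units.val_mul, FractionalIdeal.coe_mul, hI, hJ, twistModule_mul _ _ _ hv]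

theorem twistClass_congr {N u v : C} (hN : ∀ z : C, N * z ∈ (algebraMap A C).range)
    (hu : IsCoprime u N) (hv : IsCoprime v N) (h : N ∣ u - v) :
    twistClass A K hN u hu = twistClass A K hN v hv := by
  obtain ⟨I, hI⟩ := exists_units_twistModule (K := K) hN hv
  rw [twistClass_eq_mk hN hv I hI]
  exact twistClass_eq_mk hN hu I (hI.trans (twistModule_congr h).symm)

theorem twistClass_one {N : C} (hN : ∀ z : C, N * z ∈ (algebraMap A C).range) :
    twistClass A K hN 1 isCoprime_one_left = 1 := by
  rw [twistClass_eq_mk hN _ 1, map_one]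
  rw [Units.val_one, FractionalIdeal.coe_one, twistModule_one hN]

variable [IsFractionRing C K]

/-- A generator of `A u + N C` over `A` generates `C` over `C`, so it is a unit of `C`. Conversely,
`hA` makes the factor `a` invertible modulo `N`, which puts `e` itself in the module. -/
theorem twistClass_eq_one_iff {N u : C} (hN : ∀ z : C, N * z ∈ (algebraMap A C).range)
    (hu : IsCoprime u N)
    (hA : ∀ a : A, IsCoprime (algebraMap A C a) N → ∃ a' : A, N ∣ algebraMap A C (a * a') - 1) :
    twistClass A K hN u hu = 1 ↔ ∃ (e : Cˣ) (a : A), u = e * algebraMap A C a := by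
  obtain ⟨I, hI⟩ := exists_units_twistModule (K := K) hN hu
  rw [twistClass_eq_mk hN hu I hI, ClassGroup.mk_eq_one_iff, hI]
  constructor
  · rintro ⟨x, hx⟩
    have h1 : Submodule.span C {x} = (1 : Submodule C K) := by
      rw [← span_twistModule (A := A) (K := K) hu, hx]
      apply le_antisymm
      · rw [Submodule.span_le, Set.singleton_subset_iff]
        exact Submodule.subset_span (Submodule.mem_span_singleton_self x)
      · rw [Submodule.span_le]
        intro y hy
        obtain ⟨a, rfl⟩ := Submodule.mem_span_singleton.1 hy
        rw [algebra_compatible_smul C a x]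
        exact Submodule.smul_mem _ _ (Submodule.mem_span_singleton_self x)
    obtain ⟨e, rfl⟩ := exists_unit_of_span_eq_one h1
    have h2 : algebraMap C K u ∈ twistModule A K N u := ⟨1, 0, by simp⟩
    rw [hx] at h2
    obtain ⟨a, ha⟩ := Submodule.mem_span_singleton.1 h2
    refine ⟨e, a, IsFractionRing.injective C K ?_⟩
    rw [← ha, Algebra.smul_def, map_mul, IsScalarTower.algebraMap_apply A C K, mul_comm]
  · rintro ⟨e, a, rfl⟩
    refine ⟨algebraMap C K e, le_antisymm ?_ ?_⟩
    · rintro _ ⟨b, z, rfl⟩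
      obtain ⟨d, hd⟩ := hN (↑e⁻¹ * z)
      refine Submodule.mem_span_singleton.2 ⟨b * a + d, ?_⟩
      rw [Algebra.smul_def, IsScalarTower.algebraMap_apply A C K, ← map_mul, map_add, hd]
      congr 1
      rw [map_mul]
      have he : (e : C) * ↑e⁻¹ = 1 := e.mul_inv
      linear_combination (N * z) * he
    · rw [Submodule.span_le, Set.singleton_subset_iff]
      obtain ⟨a', k, hk⟩ := hA a (IsCoprime.of_mul_left_right hu)
      refine ⟨a', - e * k, ?_⟩
      rw [map_mul] at hk
      congr 1
      linear_combination (e : C) * hk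

/-- After scaling, an ideal `I` that becomes principal satisfies `I C = C`, hence `N C ⊆ I`.
Elements outside `m` are invertible modulo `N`, so one product from `I * I⁻¹` lying outside `m`
yields `u ∈ I` prime to `N`, and then `I = A u + N C`. -/
theorem exists_twistClass_of_extendedHom_eq_one [IsDomain C] [Module.IsTorsionFree A C] {N : C}
    (hN : ∀ z : C, N * z ∈ (algebraMap A C).range)
    (m : Ideal A) (hm : ∀ a ∈ m, ¬ IsCoprime (algebraMap A C a) N)
    (hm' : ∀ a ∉ m, ∃ a' : A, N ∣ algebraMap A C (a * a') - 1)
    (x : ClassGroup A) (hx : ClassGroup.extendedHom A C x = 1) :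
    ∃ (u : C) (hu : IsCoprime u N), x = twistClass A K hN u hu := by
  revert hx
  refine ClassGroup.induction K (fun I hx => ?_) x
  rw [ClassGroup.extendedHom_mk_field (L := K)] at hx
  have hspan : ∀ J : FractionalIdeal A⁰ K,
      (FractionalIdeal.extendedHom K C J : Submodule C K) = Submodule.span C (J : Set K) := by
    intro J
    change ((J.extended K _ : FractionalIdeal C⁰ K) : Submodule C K) = _
    rw [FractionalIdeal.coe_extended_eq_span]
    congr 1
    have : (IsLocalization.map K (algebraMap A C)
        (nonZeroDivisors_le_comap_nonZeroDivisors_of_injective _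
          (FaithfulSMul.algebraMap_injective A C)) : K →+* K) = RingHom.id K := by
      apply IsLocalization.ringHom_ext A⁰
      ext a
      simp [← IsScalarTower.algebraMap_apply A C K]
    rw [this]
    simp
  rw [← map_one (ClassGroup.mk (R := C) K)] at hx
  obtain ⟨b, hb⟩ : ∃ b : Kˣ, toPrincipalIdeal C K b =
      Units.map (FractionalIdeal.extendedHom K C).toMonoidHom I := by
    rw [map_one, ClassGroup.mk_eq_one_iff] at hx
    obtain ⟨y, hy⟩ := hx
    have : FractionalIdeal.spanSingleton C⁰ y =
        (Units.map (FractionalIdeal.extendedHom K C).toMonoidHom I).1 := by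
      apply FractionalIdeal.coeToSubmodule_injective
      beta_reduce
      rw [FractionalIdeal.coe_spanSingleton, hy]
    exact mem_principal_ideals_iff.2 ⟨y, this⟩
  have hmk : ∀ x : Kˣ, ClassGroup.mk K (toPrincipalIdeal A K x) = 1 := by
    intro x
    rw [ClassGroup.mk_eq_one_iff]
    exact ⟨x.1, by rw [coe_toPrincipalIdeal, FractionalIdeal.coe_spanSingleton]⟩
  have hmap : ∀ x : Kˣ, Units.map (FractionalIdeal.extendedHom K C).toMonoidHom
      (toPrincipalIdeal A K x) = toPrincipalIdeal C K x := by
    intro x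
    apply Units.ext
    apply FractionalIdeal.coeToSubmodule_injective
    change ((FractionalIdeal.extendedHom K C (toPrincipalIdeal A K x).1 : FractionalIdeal C⁰ K) :
      Submodule C K) = ((toPrincipalIdeal C K x).1 : FractionalIdeal C⁰ K)
    rw [coe_toPrincipalIdeal, coe_toPrincipalIdeal, hspan, FractionalIdeal.coe_spanSingleton]
    apply le_antisymm
    · rw [Submodule.span_le]
      intro y hy
      obtain ⟨a, rfl⟩ := (FractionalIdeal.mem_spanSingleton _).1 hy
      rw [algebra_compatible_smul C a]
      exact Submodule.smul_mem _ _ (Submodule.mem_span_singleton_self _)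
    · rw [Submodule.span_le, Set.singleton_subset_iff]
      exact Submodule.subset_span (FractionalIdeal.mem_spanSingleton_self _ _)
  set I' := I * toPrincipalIdeal A K b⁻¹ with hI'
  have hII : ClassGroup.mk K I = ClassGroup.mk K I' := by rw [hI', map_mul, hmk, mul_one]
  have hext : Units.map (FractionalIdeal.extendedHom K C).toMonoidHom I' = 1 := by
    rw [hI', map_mul, hmap, ← hb, ← map_mul, mul_inv_cancel, map_one]
  have hext' : Units.map (FractionalIdeal.extendedHom K C).toMonoidHom I'⁻¹ = 1 := by
    rw [map_inv, hext, inv_one]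
  have hs : ∀ J : (FractionalIdeal A⁰ K)ˣ,
      Units.map (FractionalIdeal.extendedHom K C).toMonoidHom J = 1 →
      Submodule.span C (J.1 : Set K) = 1 := by
    intro J h
    rw [← hspan, ← FractionalIdeal.coe_one (S := C⁰), ← Units.val_one, ← h]
    rfl
  have hs1 := hs _ hext
  have hs2 := hs _ hext'
  have hint : ∀ J : (FractionalIdeal A⁰ K)ˣ, Submodule.span C (J.1 : Set K) = 1 →
      ∀ x ∈ J.1, ∃ y : C, algebraMap C K y = x := by
    intro J h x hx
    exact Submodule.mem_one.1 (h ▸ Submodule.subset_span hx)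
  have hprod : (I'.1 : Submodule A K) * (I'⁻¹.1 : Submodule A K) = 1 := by
    rw [← FractionalIdeal.coe_mul, Units.mul_inv, FractionalIdeal.coe_one]
  -- If every product of an element of `I'` and one of its inverse came from `m`, then `1 ∈ m`,
  -- against `hm`.
  obtain ⟨i, hi, j, hj, a, ha, hij⟩ : ∃ i ∈ I'.1, ∃ j ∈ I'⁻¹.1, ∃ a ∉ m,
      algebraMap A K a = i * j := by
    by_contra! hcon
    have hle : (I'.1 : Submodule A K) * (I'⁻¹.1 : Submodule A K) ≤
        Submodule.map (Algebra.linearMap A K) m := by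
      rw [Submodule.mul_le]
      intro i hi j hj
      have h1 : i * j ∈ (1 : Submodule A K) := hprod ▸ Submodule.mul_mem_mul hi hj
      obtain ⟨a, ha⟩ := Submodule.mem_one.1 h1
      by_cases ham : a ∈ m
      · exact ⟨a, ham, ha⟩
      · exact absurd ha (hcon i hi j hj a ham)
    rw [hprod] at hle
    obtain ⟨a, ha, h1⟩ := hle (Submodule.one_le.1 le_rfl)
    have : a = 1 := IsFractionRing.injective A K (by rw [map_one]; exact h1)
    exact hm a ha (by rw [this, map_one]; exact isCoprime_one_left)
  obtain ⟨u, rfl⟩ := hint _ hs1 i hi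
  obtain ⟨v, rfl⟩ := hint _ hs2 j hj
  have huv : algebraMap A C a = u * v := by
    apply IsFractionRing.injective C K
    rw [← IsScalarTower.algebraMap_apply A C K, hij, map_mul]
  obtain ⟨a', k, hk⟩ := hm' a ha
  rw [map_mul, huv] at hk
  have hu : IsCoprime u N := ⟨v * algebraMap A C a', -k, by linear_combination hk⟩
  refine ⟨u, hu, ?_⟩
  rw [hII, twistClass_eq_mk hN hu I']
  have hNC : ∀ x ∈ Submodule.span C (I'.1 : Set K), ∀ c : C, algebraMap C K (N * c) * x ∈ I'.1 := by
    intro x hx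
    induction hx using Submodule.span_induction with
    | mem x hx =>
      intro c
      obtain ⟨d, hd⟩ := hN c
      rw [← hd, ← IsScalarTower.algebraMap_apply A C K, ← Algebra.smul_def]
      exact Submodule.smul_mem (I'.1 : Submodule A K) d hx
    | zero => intro c; rw [mul_zero]; exact Submodule.zero_mem (I'.1 : Submodule A K)
    | add x y _ _ hx hy =>
      intro c; rw [mul_add]
      exact Submodule.add_mem (I'.1 : Submodule A K) (hx c) (hy c)
    | smul d x _ hx =>
      intro c
      rw [Algebra.smul_def, ← mul_assoc, ← map_mul, mul_assoc]
      exact hx _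
  apply le_antisymm
  · intro x hx
    obtain ⟨y, rfl⟩ := hint _ hs1 x hx
    have h1 : algebraMap C K y * algebraMap C K v ∈ (1 : Submodule A K) :=
      hprod ▸ Submodule.mul_mem_mul hx hj
    obtain ⟨d, hd⟩ := Submodule.mem_one.1 h1
    have hd' : algebraMap A C d = y * v := by
      apply IsFractionRing.injective C K
      rw [← IsScalarTower.algebraMap_apply A C K, hd, map_mul]
    -- Since `y v = d` lies in `A` and `u v a' ≡ 1` modulo `N`, one has `y ≡ d a' u` modulo `N`.
    refine ⟨d * a', - k * y, ?_⟩
    rw [map_mul, hd']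
    congr 1
    linear_combination y * hk
  · rintro _ ⟨d, z, rfl⟩
    rw [map_add, map_mul, ← IsScalarTower.algebraMap_apply A C K, ← Algebra.smul_def]
    refine Submodule.add_mem (I'.1 : Submodule A K)
      (Submodule.smul_mem (I'.1 : Submodule A K) d hi) ?_
    have := hNC 1 (by rw [hs1]; exact (Submodule.one_le.1 le_rfl)) z
    rwa [mul_one] at this

end Twist

/-- Extending `A u + N C` to an intermediate ring `B`. -/
theorem extendedHom_twistClass {A B C K : Type*} [CommRing A] [IsDomain A] [CommRing B] [IsDomain B]
    [CommRing C] [Algebra A B] [Algebra A C] [Algebra B C] [IsScalarTower A B C]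
    [Field K] [Algebra A K] [Algebra B K] [Algebra C K] [IsScalarTower A C K]
    [IsScalarTower B C K] [IsScalarTower A B K] [IsFractionRing A K] [IsFractionRing B K]
    [Module.IsTorsionFree A B] {N M r : C} (hNM : N = M * r)
    (hN : ∀ z : C, N * z ∈ (algebraMap A C).range) (hM : ∀ z : C, M * z ∈ (algebraMap B C).range)
    (u : C) (hu : IsCoprime u N) (hu' : IsCoprime u M) :
    ClassGroup.extendedHom A B (twistClass A K hN u hu) = twistClass B K hM u hu' := by
  obtain ⟨I, hI⟩ := exists_units_twistModule (K := K) hN hu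
  rw [twistClass_eq_mk hN hu I hI, ClassGroup.extendedHom_mk_field (L := K), eq_comm]
  apply twistClass_eq_mk
  change ((I.1.extended K _ : FractionalIdeal B⁰ K) : Submodule B K) = _
  rw [FractionalIdeal.coe_extended_eq_span]
  have : (IsLocalization.map K (algebraMap A B)
      (nonZeroDivisors_le_comap_nonZeroDivisors_of_injective _
        (FaithfulSMul.algebraMap_injective A B)) : K →+* K) = RingHom.id K := by
    apply IsLocalization.ringHom_ext A⁰
    ext a
    simp [← IsScalarTower.algebraMap_apply A B K]
  rw [this]
  have hI' : (I.1 : Set K) = (twistModule A K N u : Set K) := by rw [← hI]; rfl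
  rw [hI', RingHom.coe_id, Set.image_id]
  apply le_antisymm
  · rw [Submodule.span_le]
    rintro _ ⟨a, z, rfl⟩
    exact ⟨algebraMap A B a, r * z, by
      rw [← IsScalarTower.algebraMap_apply A B C, hNM, mul_assoc]⟩
  · rintro _ ⟨b, z, rfl⟩
    obtain ⟨w, k, h⟩ : IsCoprime u r := (hNM ▸ hu).of_mul_right_right
    obtain ⟨d, hd⟩ := hM (z * w)
    -- From `w u + k r = 1` comes `M z = (M z w) u + N (k z)`, and `M z w` already lies in `B`.
    have e : algebraMap C K (algebraMap B C b * u + M * z) =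
        (b + d) • algebraMap C K (algebraMap A C 1 * u + N * 0) +
          (1 : B) • algebraMap C K (algebraMap A C 0 * u + N * (k * z)) := by
      rw [Algebra.smul_def, Algebra.smul_def, IsScalarTower.algebraMap_apply B C K,
        IsScalarTower.algebraMap_apply B C K, ← map_mul, ← map_mul, ← map_add]
      congr 1
      rw [map_add, hd, hNM, map_one, map_zero, map_one]
      linear_combination (-M * z) * h
    rw [e]
    exact add_mem (Submodule.smul_mem _ _ (Submodule.subset_span ⟨_, _, rfl⟩))
      (Submodule.smul_mem _ _ (Submodule.subset_span ⟨_, _, rfl⟩))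

/-! ### Basic facts on the orders and on maps between their class groups. -/

theorem not_isUnit_natCast_quadOrder (K : Type*) [Field K] [NumberField K] (f : ℕ) {p : ℕ}
    (hp : p.Prime) : ¬ IsUnit ((p : ℕ) : quadOrder K f) := by
  intro h
  have h1 : IsUnit ((p : ℕ) : 𝓞 K) := by
    simpa using h.map (quadOrder K f).subtype
  have h2 := h1.map (Algebra.norm ℤ)
  have h3 : ((p : ℕ) : 𝓞 K) = algebraMap ℤ (𝓞 K) p := by simp
  rw [h3, Algebra.norm_algebraMap, isUnit_pow_iff (Module.finrank_pos).ne', Int.isUnit_iff] at h2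
  have := hp.two_le
  omega

instance isFractionRing_quadOrder (K : Type*) [Field K] [NumberField K] (f : ℕ) [NeZero f] :
    IsFractionRing (quadOrder K f) K := by
  have hinj : Function.Injective (algebraMap (quadOrder K f) K) := by
    intro x y h
    exact Subtype.ext (RingOfIntegers.coe_injective h)
  have := faithfulSMul_iff_algebraMap_injective (quadOrder K f) K |>.2 hinj
  apply IsFractionRing.of_field
  intro z
  obtain ⟨x, y, hy, rfl⟩ := IsFractionRing.div_surjective (A := 𝓞 K) z
  have hf : (f : 𝓞 K) ≠ 0 := Nat.cast_ne_zero.2 (NeZero.ne f)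
  have hfK : (f : K) ≠ 0 := Nat.cast_ne_zero.2 (NeZero.ne f)
  -- Multiplying numerator and denominator by the conductor puts both in the order.
  refine ⟨⟨f * x, 0, x, by simp⟩, ⟨f * y, 0, y, by simp⟩, ?_⟩
  change algebraMap (𝓞 K) K x / algebraMap (𝓞 K) K y =
    algebraMap (𝓞 K) K (f * x) / algebraMap (𝓞 K) K (f * y)
  rw [map_mul, map_mul, map_natCast, mul_div_mul_left _ _ hfK]

theorem subringClassMap_eq {R : Type*} [CommRing R] [IsDomain R] {A B : Subring R} (h : A ≤ B)
    [i : Algebra A B] [j : Module.IsTorsionFree A B] (hi : i = (Subring.inclusion h).toAlgebra) :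
    subringClassMap h = ClassGroup.extendedHom A B := by
  subst hi
  rfl

theorem ClassGroup.extendedHom_self (A : Type*) [CommRing A] [IsDomain A] (x : ClassGroup A) :
    ClassGroup.extendedHom A A x = x := by
  refine ClassGroup.induction (FractionRing A) (fun I => ?_) x
  rw [ClassGroup.extendedHom_mk]
  congr 1
  apply Units.ext
  have h := FractionalIdeal.canonicalEquiv_eq_extended (L := FractionRing A) I.1
  rw [FractionalIdeal.canonicalEquiv_self] at h
  exact h.symm

theorem subringClassMap_self {R : Type*} [CommRing R] [IsDomain R] {A : Subring R} (h : A ≤ A)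
    (x : ClassGroup A) : subringClassMap h x = x := by
  rw [subringClassMap_eq (i := Algebra.id A) h (Algebra.algebra_ext _ _ fun _ => rfl)]
  exact ClassGroup.extendedHom_self A x

/-- The elements `n + p ^ e z` with `n` an integer. -/
def Level {C : Type*} [CommRing C] (p e : ℕ) (u : C) : Prop :=
  ∃ (a : ℤ) (z : C), u = a + p ^ e * z

/-! ### The kernel of `Cl(𝓞_d) → Cl(𝓞_0)` in terms of elements of `𝓞_0`. -/

section Phi

variable (K : Type*) [Field K] (ℓ c : ℕ)

theorem level_iff {d : ℕ} (u : quadOrder K (c * ℓ ^ 0)) :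
    Level ℓ d u ↔ (u : 𝓞 K) ∈ quadOrder K (c * ℓ ^ d) := by
  constructor
  · rintro ⟨a, ⟨_, b, y, rfl⟩, rfl⟩
    exact ⟨a + ℓ ^ d * b, y, by push_cast; ring⟩
  · rintro ⟨a, y, h⟩
    exact ⟨a, ⟨c * y, 0, y, by simp⟩, Subtype.ext (by rw [h]; push_cast; ring)⟩

theorem quadOrder_le_zero (d : ℕ) : quadOrder K (c * ℓ ^ d) ≤ quadOrder K (c * ℓ ^ 0) :=
  quadOrder_le K (mul_dvd_mul_left c (pow_dvd_pow ℓ (Nat.zero_le d)))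

theorem natCast_pow_mul_mem_range (d : ℕ) (z : quadOrder K (c * ℓ ^ 0)) :
    letI := (Subring.inclusion (quadOrder_le_zero K ℓ c d)).toAlgebra
    (ℓ : quadOrder K (c * ℓ ^ 0)) ^ d * z ∈
      (algebraMap (quadOrder K (c * ℓ ^ d)) (quadOrder K (c * ℓ ^ 0))).range :=
  ⟨⟨((ℓ : quadOrder K (c * ℓ ^ 0)) ^ d * z : quadOrder K (c * ℓ ^ 0)),
    (level_iff K ℓ c _).1 ⟨0, z, by rw [Int.cast_zero, zero_add]⟩⟩, rfl⟩

variable [NumberField K] [NeZero ℓ] [NeZero c]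

open Classical in
/-- The class of `𝓞_d u + ℓ^d 𝓞_0` in `Cl(𝓞_d)`, for `u` in `𝓞_0` prime to `ℓ`. -/
def phi (d : ℕ) (u : quadOrder K (c * ℓ ^ 0)) : ClassGroup (quadOrder K (c * ℓ ^ d)) :=
  letI := (Subring.inclusion (quadOrder_le_zero K ℓ c d)).toAlgebra
  haveI : IsScalarTower (quadOrder K (c * ℓ ^ d)) (quadOrder K (c * ℓ ^ 0)) K :=
    IsScalarTower.of_algebraMap_eq fun _ => rfl
  if hu : IsCoprime u (ℓ : quadOrder K (c * ℓ ^ 0)) then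
    twistClass _ K (natCast_pow_mul_mem_range K ℓ c d) u (hu.pow_right)
  else 1

variable {K ℓ c}

theorem phi_mul (d : ℕ) {u v : quadOrder K (c * ℓ ^ 0)} (hu : IsCoprime u (ℓ : quadOrder K (c * ℓ ^ 0)))
    (hv : IsCoprime v (ℓ : quadOrder K (c * ℓ ^ 0))) :
    phi K ℓ c d (u * v) = phi K ℓ c d u * phi K ℓ c d v := by
  let _ := (Subring.inclusion (quadOrder_le_zero K ℓ c d)).toAlgebra
  have : IsScalarTower (quadOrder K (c * ℓ ^ d)) (quadOrder K (c * ℓ ^ 0)) K :=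
    IsScalarTower.of_algebraMap_eq fun _ => rfl
  unfold phi
  rw [dif_pos hu, dif_pos hv, dif_pos (hu.mul_left hv)]
  exact twistClass_mul _ _ _

theorem phi_congr (d : ℕ) {u v : quadOrder K (c * ℓ ^ 0)}
    (hu : IsCoprime u (ℓ : quadOrder K (c * ℓ ^ 0)))
    (hv : IsCoprime v (ℓ : quadOrder K (c * ℓ ^ 0)))
    (h : (ℓ : quadOrder K (c * ℓ ^ 0)) ^ d ∣ u - v) : phi K ℓ c d u = phi K ℓ c d v := by
  let _ := (Subring.inclusion (quadOrder_le_zero K ℓ c d)).toAlgebra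
  have : IsScalarTower (quadOrder K (c * ℓ ^ d)) (quadOrder K (c * ℓ ^ 0)) K :=
    IsScalarTower.of_algebraMap_eq fun _ => rfl
  unfold phi
  rw [dif_pos hu, dif_pos hv]
  exact twistClass_congr _ _ _ h

theorem phi_one (d : ℕ) : phi K ℓ c d 1 = 1 := by
  let _ := (Subring.inclusion (quadOrder_le_zero K ℓ c d)).toAlgebra
  have : IsScalarTower (quadOrder K (c * ℓ ^ d)) (quadOrder K (c * ℓ ^ 0)) K :=
    IsScalarTower.of_algebraMap_eq fun _ => rfl
  unfold phi
  rw [dif_pos isCoprime_one_left]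
  exact twistClass_one _

theorem phi_pow (d : ℕ) {u : quadOrder K (c * ℓ ^ 0)}
    (hu : IsCoprime u (ℓ : quadOrder K (c * ℓ ^ 0))) (n : ℕ) :
    phi K ℓ c d (u ^ n) = phi K ℓ c d u ^ n := by
  induction n with
  | zero => exact (congrArg _ (pow_zero u)).trans ((phi_one d).trans (pow_zero _).symm)
  | succ n ih => rw [pow_succ, pow_succ, phi_mul d (hu.pow_left) hu, ih]

theorem classMap_phi {d e : ℕ} (h : d ≤ e) {u : quadOrder K (c * ℓ ^ 0)}
    (hu : IsCoprime u (ℓ : quadOrder K (c * ℓ ^ 0))) :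
    subringClassMap (quadOrder_le K (mul_dvd_mul_left c (pow_dvd_pow ℓ h))) (phi K ℓ c e u) =
      phi K ℓ c d u := by
  let _ := (Subring.inclusion (quadOrder_le_zero K ℓ c d)).toAlgebra
  let _ := (Subring.inclusion (quadOrder_le_zero K ℓ c e)).toAlgebra
  let _ := (Subring.inclusion (quadOrder_le K
    (mul_dvd_mul_left c (pow_dvd_pow ℓ h)))).toAlgebra
  have : IsScalarTower (quadOrder K (c * ℓ ^ d)) (quadOrder K (c * ℓ ^ 0)) K :=
    IsScalarTower.of_algebraMap_eq fun _ => rfl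
  have : IsScalarTower (quadOrder K (c * ℓ ^ e)) (quadOrder K (c * ℓ ^ 0)) K :=
    IsScalarTower.of_algebraMap_eq fun _ => rfl
  have : IsScalarTower (quadOrder K (c * ℓ ^ e)) (quadOrder K (c * ℓ ^ d)) K :=
    IsScalarTower.of_algebraMap_eq fun _ => rfl
  have : IsScalarTower (quadOrder K (c * ℓ ^ e)) (quadOrder K (c * ℓ ^ d))
    (quadOrder K (c * ℓ ^ 0)) := IsScalarTower.of_algebraMap_eq fun _ => rfl
  have : Module.IsTorsionFree (quadOrder K (c * ℓ ^ e)) (quadOrder K (c * ℓ ^ d)) :=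
    Module.isTorsionFree_iff_algebraMap_injective.mpr (Subring.inclusion_injective _)
  rw [subringClassMap_eq _ rfl]
  unfold phi
  rw [dif_pos hu, dif_pos hu]
  exact extendedHom_twistClass (r := (ℓ : quadOrder K (c * ℓ ^ 0)) ^ (e - d))
    (by rw [← pow_add, Nat.add_sub_cancel' h]) _ _ _ _ _

theorem exists_mul_sub_one_of_not_dvd {C : Type*} [CommRing C] {p : ℕ} (hp : p.Prime) (d : ℕ)
    (m : ℤ) (hm : ¬ (p : ℤ) ∣ m) : ∃ n : ℤ, (p : C) ^ d ∣ m * n - 1 := by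
  obtain ⟨x, y, h⟩ : IsCoprime m ((p : ℤ) ^ d) :=
    (((Nat.prime_iff_prime_int.1 hp).coprime_iff_not_dvd).2 hm).symm.pow_right
  refine ⟨x, -y, ?_⟩
  have := congrArg (Int.cast (R := C)) h
  push_cast at this
  linear_combination this

theorem not_dvd_of_isCoprime {C : Type*} [CommRing C] {p : ℕ} (hpC : ¬ IsUnit (p : C)) {m : ℤ}
    {z : C} (h : IsCoprime ((m : C) + p * z) p) : ¬ (p : ℤ) ∣ m := by
  rintro ⟨k, rfl⟩
  have : IsCoprime (p : C) p := by
    refine h.of_isCoprime_of_dvd_left ⟨k + z, ?_⟩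
    push_cast; ring
  exact hpC (isCoprime_self.1 this)

variable [Fact ℓ.Prime]

theorem phi_eq_one_iff (d : ℕ) {u : quadOrder K (c * ℓ ^ 0)}
    (hu : IsCoprime u (ℓ : quadOrder K (c * ℓ ^ 0))) :
    phi K ℓ c d u = 1 ↔ ∃ (e : (quadOrder K (c * ℓ ^ 0))ˣ) (a : quadOrder K (c * ℓ ^ 0)),
      Level ℓ d a ∧ u = (e : quadOrder K (c * ℓ ^ 0)) * a := by
  let _ := (Subring.inclusion (quadOrder_le_zero K ℓ c d)).toAlgebra
  have : IsScalarTower (quadOrder K (c * ℓ ^ d)) (quadOrder K (c * ℓ ^ 0)) K :=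
    IsScalarTower.of_algebraMap_eq fun _ => rfl
  have hp : ℓ.Prime := Fact.out
  unfold phi
  rw [dif_pos hu, twistClass_eq_one_iff]
  · constructor
    · rintro ⟨e, a, h⟩
      exact ⟨e, _, (level_iff K ℓ c (algebraMap _ _ a)).2 a.2, h⟩
    · rintro ⟨e, a, h1, h2⟩
      exact ⟨e, ⟨a, (level_iff K ℓ c _).1 h1⟩, h2⟩
  · intro a ha
    rcases Nat.eq_zero_or_pos d with rfl | hd
    · exact ⟨1, by rw [pow_zero (ℓ : quadOrder K (c * ℓ ^ 0))]; exact one_dvd _⟩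
    obtain ⟨m, z, h⟩ := (level_iff K ℓ c
      (algebraMap (quadOrder K (c * ℓ ^ d)) (quadOrder K (c * ℓ ^ 0)) a)).2 a.2
    replace h : algebraMap (quadOrder K (c * ℓ ^ d)) (quadOrder K (c * ℓ ^ 0)) a =
        (m : quadOrder K (c * ℓ ^ 0)) + (ℓ : quadOrder K (c * ℓ ^ 0)) ^ d * z := h
    rw [h, IsCoprime.pow_right_iff hd, ← Nat.succ_pred_eq_of_pos hd, pow_succ', mul_assoc] at ha
    obtain ⟨n, hn⟩ := exists_mul_sub_one_of_not_dvd (C := quadOrder K (c * ℓ ^ 0)) hp d m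
      (not_dvd_of_isCoprime (not_isUnit_natCast_quadOrder K _ hp) ha)
    refine ⟨n, ?_⟩
    rw [map_mul, h, map_intCast, add_mul, add_sub_right_comm]
    exact dvd_add hn ⟨z * n, by ring⟩

theorem exists_phi_of_classMap_eq_one (d : ℕ) (x : ClassGroup (quadOrder K (c * ℓ ^ d)))
    (hx : subringClassMap (quadOrder_le_zero K ℓ c d) x = 1) :
    ∃ u : quadOrder K (c * ℓ ^ 0), IsCoprime u (ℓ : quadOrder K (c * ℓ ^ 0)) ∧
      x = phi K ℓ c d u := by
  have hp : ℓ.Prime := Fact.out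
  rcases Nat.eq_zero_or_pos d with rfl | hd
  · refine ⟨1, isCoprime_one_left, ?_⟩
    rw [phi_one, ← hx, subringClassMap_self]
  let _ := (Subring.inclusion (quadOrder_le_zero K ℓ c d)).toAlgebra
  have : IsScalarTower (quadOrder K (c * ℓ ^ d)) (quadOrder K (c * ℓ ^ 0)) K :=
    IsScalarTower.of_algebraMap_eq fun _ => rfl
  have : Module.IsTorsionFree (quadOrder K (c * ℓ ^ d)) (quadOrder K (c * ℓ ^ 0)) :=
    Module.isTorsionFree_iff_algebraMap_injective.mpr (Subring.inclusion_injective _)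
  rw [subringClassMap_eq _ rfl] at hx
  -- The ideal `m` is the contraction of `ℓ 𝓞_0`: an element of `𝓞_d` outside it is congruent modulo
  -- `ℓ^d` to an integer prime to `ℓ`.
  have h1 : ∀ a ∈ (Ideal.span {(ℓ : quadOrder K (c * ℓ ^ 0))}).comap
      (algebraMap (quadOrder K (c * ℓ ^ d)) (quadOrder K (c * ℓ ^ 0))),
      ¬ IsCoprime (algebraMap (quadOrder K (c * ℓ ^ d)) (quadOrder K (c * ℓ ^ 0)) a)
        ((ℓ : quadOrder K (c * ℓ ^ 0)) ^ d) := by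
    intro a ha hc
    rw [Ideal.mem_comap, Ideal.mem_span_singleton] at ha
    exact not_isUnit_natCast_quadOrder K _ hp
      (isCoprime_self.1 (((IsCoprime.pow_right_iff hd).1 hc).of_isCoprime_of_dvd_left ha))
  have h2 : ∀ a ∉ (Ideal.span {(ℓ : quadOrder K (c * ℓ ^ 0))}).comap
      (algebraMap (quadOrder K (c * ℓ ^ d)) (quadOrder K (c * ℓ ^ 0))),
      ∃ a', (ℓ : quadOrder K (c * ℓ ^ 0)) ^ d ∣
        algebraMap (quadOrder K (c * ℓ ^ d)) (quadOrder K (c * ℓ ^ 0)) (a * a') - 1 := by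
    intro a ha
    obtain ⟨m, z, h⟩ := (level_iff K ℓ c
      (algebraMap (quadOrder K (c * ℓ ^ d)) (quadOrder K (c * ℓ ^ 0)) a)).2 a.2
    replace h : algebraMap (quadOrder K (c * ℓ ^ d)) (quadOrder K (c * ℓ ^ 0)) a =
        (m : quadOrder K (c * ℓ ^ 0)) + (ℓ : quadOrder K (c * ℓ ^ 0)) ^ d * z := h
    rw [Ideal.mem_comap, Ideal.mem_span_singleton, h] at ha
    obtain ⟨n, hn⟩ := exists_mul_sub_one_of_not_dvd (C := quadOrder K (c * ℓ ^ 0)) hp d m (by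
      rintro ⟨k, rfl⟩
      refine ha (dvd_add ⟨k, by push_cast; ring⟩ ((dvd_pow_self _ hd.ne').mul_right _)))
    refine ⟨n, ?_⟩
    rw [map_mul, h, map_intCast, add_mul, add_sub_right_comm]
    exact dvd_add hn ⟨z * n, by ring⟩
  obtain ⟨u, hu, h⟩ := exists_twistClass_of_extendedHom_eq_one (K := K)
    (natCast_pow_mul_mem_range K ℓ c d)
    _ h1 h2 x hx
  have hu' := (IsCoprime.pow_right_iff hd).1 hu
  refine ⟨u, hu', ?_⟩
  unfold phi
  rw [dif_pos hu', h]

end Phi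

/-! ### Levels, units and `ℓ`-th powers in a ring with integral basis `1, η`. -/

theorem Level.mono {C : Type*} [CommRing C] {p d e : ℕ} (h : d ≤ e) {u : C} (hu : Level p e u) :
    Level p d u := by
  obtain ⟨a, z, rfl⟩ := hu
  exact ⟨a, p ^ (e - d) * z, by rw [← mul_assoc, ← pow_add, Nat.add_sub_cancel' h]⟩

theorem level_intCast {C : Type*} [CommRing C] (p e : ℕ) (n : ℤ) : Level p e (n : C) :=
  ⟨n, 0, by simp⟩

theorem level_zero {C : Type*} [CommRing C] (p : ℕ) (u : C) : Level p 0 u :=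
  ⟨0, u, by simp⟩

theorem Level.neg {C : Type*} [CommRing C] {p e : ℕ} {u : C} (hu : Level p e u) :
    Level p e (-u) := by
  obtain ⟨a, z, rfl⟩ := hu
  exact ⟨-a, -z, by push_cast; ring⟩

theorem exists_add_pow_eq {C : Type*} [CommRing C] (x y : C) (n : ℕ) :
    ∃ k : C, (x + y) ^ (n + 2) =
      x ^ (n + 2) + (n + 2 : ℕ) * x ^ (n + 1) * y + ((n + 2).choose 2 : ℕ) * x ^ n * y ^ 2
        + k * y ^ 3 := by
  induction n with
  | zero => exact ⟨0, by norm_num; ring⟩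
  | succ n ih =>
    obtain ⟨k, hk⟩ := ih
    refine ⟨((n + 2).choose 2 : ℕ) * x ^ n + k * (x + y), ?_⟩
    rw [pow_succ, hk, show (n + 1 + 2).choose 2 = (n + 2) + (n + 2).choose 2 by
      rw [Nat.choose_succ_succ' (n + 2) 1, Nat.choose_one_right]]
    push_cast
    ring

/-- In the binomial expansion the linear term gains a factor `p`, and the higher terms carry at
least `p ^ (2 * e)`, which suffices as `e ≥ 1`. -/
theorem Level.pow_prime {C : Type*} [CommRing C] {p e : ℕ} (hp : p.Prime) {u : C}
    (he : 1 ≤ e) (hl : Level p e u) :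
    Level p (e + 1) (u ^ p) := by
  obtain ⟨m, z, rfl⟩ := hl
  obtain ⟨n, hn⟩ : ∃ n, p = n + 2 := ⟨p - 2, by have := hp.two_le; omega⟩
  obtain ⟨e, rfl⟩ := Nat.exists_eq_add_of_le' he
  obtain ⟨k, hk⟩ := exists_add_pow_eq (m : C) (p ^ (e + 1) * z) n
  rw [← hn] at hk
  rw [hk]
  refine ⟨m ^ p, m ^ (n + 1) * z + p.choose 2 * m ^ n * p ^ e * z ^ 2 +
    k * p ^ (2 * e + 1) * z ^ 3, ?_⟩
  push_cast
  ring

/-- `C` has the integral basis `1, η`, where `η ^ 2 = T η - N`. -/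
structure IsQuadBasis {C : Type*} [CommRing C] (η : C) (T N : ℤ) : Prop where
  sq : η * η = T * η - N
  span : ∀ x : C, ∃ a b : ℤ, x = a + b * η
  indep : ∀ a b : ℤ, (a : C) + b * η = 0 → a = 0 ∧ b = 0

namespace IsQuadBasis

variable {C : Type*} [CommRing C] {η : C} {T N : ℤ} (h : IsQuadBasis η T N)

include h

theorem ext {a b a' b' : ℤ} (e : (a : C) + b * η = a' + b' * η) : a = a' ∧ b = b' := by
  have := h.indep (a - a') (b - b') (by push_cast; linear_combination e)
  omega

theorem level_iff (p e : ℕ) (a b : ℤ) : Level p e ((a : C) + b * η) ↔ (p : ℤ) ^ e ∣ b := by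
  constructor
  · rintro ⟨a', z, hz⟩
    obtain ⟨x, y, rfl⟩ := h.span z
    have := h.ext (a := a) (b := b) (a' := a' + p ^ e * x) (b' := p ^ e * y)
      (by rw [hz]; push_cast; ring)
    exact ⟨y, this.2⟩
  · rintro ⟨y, rfl⟩
    exact ⟨a, y * η, by push_cast; ring⟩

theorem not_isUnit {p : ℕ} (hp : p.Prime) : ¬ IsUnit (p : C) := by
  rintro ⟨u, hu⟩
  obtain ⟨a, b, hab⟩ := h.span ↑u⁻¹
  have h1 : (p : C) * (a + b * η) = 1 := by rw [← hab, ← hu, u.mul_inv]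
  have := h.ext (a := p * a) (b := p * b) (a' := 1) (b' := 0)
    (by push_cast; linear_combination h1)
  have h2 := Int.isUnit_iff.1 (IsUnit.of_mul_eq_one _ this.1)
  have := hp.two_le
  omega

/-- The norm form is multiplicative, so a unit has norm `±1`; negative discriminant makes the form
nonnegative. -/
theorem norm_eq_one {a b : ℤ} (hD : T ^ 2 - 4 * N ≤ -3) (hu : IsUnit ((a : C) + b * η)) :
    a ^ 2 + a * b * T + b ^ 2 * N = 1 := by
  obtain ⟨u, hu⟩ := hu
  obtain ⟨a', b', hab⟩ := h.span ↑u⁻¹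
  have h1 : ((a : C) + b * η) * (a' + b' * η) = 1 := by rw [← hab, ← hu, u.mul_inv]
  obtain ⟨e1, e2⟩ := h.ext (a := a * a' - b * b' * N) (b := a * b' + a' * b + b * b' * T)
    (a' := 1) (b' := 0) (by push_cast; linear_combination h1 - b * b' * h.sq)
  have h2 : (a ^ 2 + a * b * T + b ^ 2 * N) * (a' ^ 2 + a' * b' * T + b' ^ 2 * N) = 1 := by
    have : (a ^ 2 + a * b * T + b ^ 2 * N) * (a' ^ 2 + a' * b' * T + b' ^ 2 * N) =
      (a * a' - b * b' * N) ^ 2 + (a * a' - b * b' * N) * (a * b' + a' * b + b * b' * T) * T +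
        (a * b' + a' * b + b * b' * T) ^ 2 * N := by ring
    rw [this, e1, e2]; ring
  have h3 : 0 ≤ a ^ 2 + a * b * T + b ^ 2 * N := by nlinarith [sq_nonneg (2 * a + b * T)]
  rcases Int.isUnit_iff.1 (IsUnit.of_mul_eq_one _ h2) with h4 | h4
  · exact h4
  · omega

theorem eq_one_or_of_isUnit {a b : ℤ} (hD : T ^ 2 - 4 * N ≤ -3) (hu : IsUnit ((a : C) + b * η))
    (hb : b = 0) : (a : C) + b * η = 1 ∨ (a : C) + b * η = -1 := by
  have h1 := h.norm_eq_one hD hu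
  subst hb
  have h2 : a * a = 1 := by linear_combination h1
  rcases Int.isUnit_iff.1 (IsUnit.of_mul_eq_one _ h2) with h4 | h4 <;> simp [h4]

/-- If `a + bη` has norm 1, then `4 = (2a + bT)² + |Δ| b²`. With `p ∣ b` and `b ≠ 0` the right side
is at least `3 p² ≥ 12`. -/
theorem unit_eq_of_level {p : ℕ} (hp : p.Prime) (hD : T ^ 2 - 4 * N ≤ -3) (u : Cˣ)
    (hu : Level p 1 (u : C)) : (u : C) = 1 ∨ (u : C) = -1 := by
  obtain ⟨a, b, hab⟩ := h.span u
  rw [hab] at hu ⊢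
  have huu : IsUnit ((a : C) + b * η) := hab ▸ u.isUnit
  apply h.eq_one_or_of_isUnit hD huu
  have h1 := h.norm_eq_one hD huu
  obtain ⟨k, rfl⟩ := (h.level_iff p 1 a b).1 hu
  have hp2 : (2 : ℤ) ≤ p := by exact_mod_cast hp.two_le
  by_contra hk
  have h5 : 1 ≤ k ^ 2 := by
    have : k ≠ 0 := by rintro rfl; simp at hk
    have := sq_pos_of_ne_zero this
    omega
  have h6 : (4 : ℤ) ≤ (p : ℤ) ^ 2 := by nlinarith
  have h7 : (4 : ℤ) ≤ (p : ℤ) ^ 2 * k ^ 2 := by nlinarith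
  nlinarith [sq_nonneg (2 * a + p ^ 1 * k * T)]

theorem unit_eq_of_discr (hD : T ^ 2 - 4 * N ≤ -3) (h3 : T ^ 2 - 4 * N ≠ -3)
    (h4 : T ^ 2 - 4 * N ≠ -4) (u : Cˣ) : (u : C) = 1 ∨ (u : C) = -1 := by
  obtain ⟨a, b, hab⟩ := h.span u
  have huu : IsUnit ((a : C) + b * η) := hab ▸ u.isUnit
  rw [hab]
  apply h.eq_one_or_of_isUnit hD huu
  have h1 := h.norm_eq_one hD huu
  by_contra hk
  have := sq_pos_of_ne_zero hk
  have h5 : T ^ 2 - 4 * N ≤ -5 := by omega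
  nlinarith [sq_nonneg (2 * a + b * T)]

/-- If `u = e * a` and both `u` and `a` have level at least 1, then so does `e`, because `a` is an
invertible integer modulo `p`. Hence `e = ±1`, and no assumption on the full unit group is needed.
-/
theorem exists_unit_mul_iff {p d : ℕ} (hp : p.Prime) (hD : T ^ 2 - 4 * N ≤ -3) (hd : 1 ≤ d) {u : C}
    (hu : IsCoprime u (p : C))
    (hu1 : Level p 1 u ∨ ∀ e : Cˣ, (e : C) = 1 ∨ (e : C) = -1) :
    (∃ (e : Cˣ) (a : C), Level p d a ∧ u = e * a) ↔ Level p d u := by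
  constructor
  · rintro ⟨e, a, ha, rfl⟩
    have he : (e : C) = 1 ∨ (e : C) = -1 := by
      rcases hu1 with hu1 | hu1
      · apply h.unit_eq_of_level hp hD
        have ha1 := ha.mono hd
        obtain ⟨m, z, rfl⟩ := ha1
        rw [pow_one] at hu hu1
        have hm : ¬ (p : ℤ) ∣ m :=
          not_dvd_of_isCoprime (h.not_isUnit hp) (IsCoprime.of_mul_left_right hu)
        obtain ⟨n, k, hk⟩ := exists_mul_sub_one_of_not_dvd (C := C) hp 1 m hm
        rw [pow_one] at hk
        obtain ⟨n', z', hz'⟩ := hu1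
        refine ⟨n * n', n * z' - n * e * z - e * k, ?_⟩
        push_cast
        linear_combination (n : C) * hz' - e * hk
      · exact hu1 e
    rcases he with he | he <;> rw [he]
    · simpa using ha
    · simpa using ha.neg
  · intro hl
    exact ⟨1, u, hl, by simp⟩

/-- The `η`-coefficient of `(m + p^e b η)^p` is `p^(e+1)` times something congruent to a `p`-unit.
For odd `p` the quadratic term is harmless since `p` divides `p.choose 2`. For `p = 2` it
contributes `2^(e-1) b² T`, which explains the condition `h2`. -/
theorem level_pow_prime {p e : ℕ} (hp : p.Prime) {u : C} (hu : IsCoprime u (p : C))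
    (he : 1 ≤ e) (h2 : p = 2 → 2 ≤ e ∨ Even T) (hl : Level p e u) (hl' : ¬ Level p (e + 1) u) :
    Level p (e + 1) (u ^ p) ∧ ¬ Level p (e + 2) (u ^ p) := by
  obtain ⟨m, b, rfl⟩ := h.span u
  obtain ⟨b, rfl⟩ := (h.level_iff p e m b).1 hl
  rw [h.level_iff, pow_succ] at hl'
  have hp0 : (p : ℤ) ≠ 0 := by exact_mod_cast hp.ne_zero
  have hpe : (p : ℤ) ^ e ≠ 0 := pow_ne_zero _ hp0
  have hb : ¬ (p : ℤ) ∣ b := fun hb => hl' (mul_dvd_mul_left _ hb)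
  have hm : ¬ (p : ℤ) ∣ m := by
    apply not_dvd_of_isCoprime (h.not_isUnit hp) (z := (p ^ (e - 1) * b : ℤ) * η)
    convert hu using 2
    obtain ⟨e, rfl⟩ := Nat.exists_eq_add_of_le' he
    push_cast
    ring
  have hpi : Prime (p : ℤ) := Nat.prime_iff_prime_int.1 hp
  obtain ⟨x, y, hxy, hy⟩ : ∃ x y : ℤ, ((m : C) + ((p ^ e * b : ℤ) : C) * η) ^ p =
      x + (p ^ (e + 1) * y : ℤ) * η ∧ ¬ (p : ℤ) ∣ y := by
    rcases hp.eq_two_or_odd' with rfl | hodd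
    · refine ⟨m ^ 2 - 4 ^ e * b ^ 2 * N, m * b + 2 ^ (e - 1) * b ^ 2 * T, ?_, ?_⟩
      · obtain ⟨e, rfl⟩ := Nat.exists_eq_add_of_le' he
        simp only [Nat.add_sub_cancel]
        push_cast
        rw [show (4 : C) = 2 * 2 by norm_num, mul_pow]
        linear_combination (2 ^ (e + 1) * 2 ^ (e + 1) * b ^ 2 : C) * h.sq
      · intro hdvd
        have h3 : ((2 : ℕ) : ℤ) ∣ 2 ^ (e - 1) * b ^ 2 * T := by
          rcases h2 rfl with h2 | h2
          · exact ((dvd_pow_self _ (by omega)).mul_right _).mul_right _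
          · exact h2.two_dvd.mul_left _
        have := (dvd_add_left h3).1 hdvd
        rcases hpi.dvd_or_dvd this with h4 | h4
        · exact hm h4
        · exact hb h4
    · obtain ⟨n, hn⟩ : ∃ n, p = n + 2 := ⟨p - 2, by have := hp.two_le; omega⟩
      obtain ⟨k, hk⟩ := exists_add_pow_eq (m : C) (((p ^ e * b : ℤ) : C) * η) n
      rw [← hn] at hk
      have hch : (p : ℕ) ∣ p.choose 2 :=
        hp.dvd_choose_self (by norm_num) (lt_of_le_of_ne hp.two_le (by
          rintro rfl; exact absurd hodd (by decide)))
      obtain ⟨r, hr⟩ := hch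
      obtain ⟨e', rfl⟩ := Nat.exists_eq_add_of_le' he
      obtain ⟨x, y, hz⟩ := h.span
        ((r : C) * m ^ n * p ^ e' * b ^ 2 * η ^ 2 + k * p ^ (2 * e') * b ^ 3 * η ^ 3)
      refine ⟨m ^ p + p ^ (e' + 3) * x, m ^ (n + 1) * b + p * y, ?_, ?_⟩
      · rw [hk, hr]
        push_cast
        have e1 : (p : C) ^ (e' + 3) * ((x : C) + y * η) = p ^ (e' + 3) *
          ((r : C) * m ^ n * p ^ e' * b ^ 2 * η ^ 2 + k * p ^ (2 * e') * b ^ 3 * η ^ 3) := by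
          rw [hz]
        linear_combination -e1
      · intro hdvd
        have h3 := (dvd_add_left (dvd_mul_right (p : ℤ) y)).1 hdvd
        rcases hpi.dvd_or_dvd h3 with h4 | h4
        · exact hm (hpi.dvd_of_dvd_pow h4)
        · exact hb h4
  rw [hxy, h.level_iff, h.level_iff]
  refine ⟨dvd_mul_right _ _, ?_⟩
  rw [pow_succ (p : ℤ) (e + 1)]
  exact fun h6 => hy ((mul_dvd_mul_iff_left (pow_ne_zero _ hp0)).1 h6)

theorem level_pow_prime_pow {p e : ℕ} (hp : p.Prime) {u : C} (hu : IsCoprime u (p : C))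
    (he : 1 ≤ e) (h2 : p = 2 → 2 ≤ e ∨ Even T) (hl : Level p e u) (hl' : ¬ Level p (e + 1) u)
    (j : ℕ) : Level p (e + j) (u ^ p ^ j) ∧ ¬ Level p (e + j + 1) (u ^ p ^ j) := by
  induction j with
  | zero => simpa using ⟨hl, hl'⟩
  | succ j ih =>
    rw [pow_succ, pow_mul]
    exact h.level_pow_prime (e := e + j) hp hu.pow_left (by omega) (fun h' => (h2 h').imp_left (by omega))
      ih.1 ih.2

end IsQuadBasis

/-! ### Integral basis, discriminant and ramification of `K`. -/

theorem exists_isQuadBasis (K : Type*) [Field K] [NumberField K] (hK : Module.finrank ℚ K = 2) :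
    ∃ (ω : 𝓞 K) (t n : ℤ), IsQuadBasis ω t n ∧ discr K = t ^ 2 - 4 * n := by
  have hr : Module.finrank ℤ (𝓞 K) = 2 := by rw [RingOfIntegers.rank, hK]
  let b : Module.Basis (Fin 2) ℤ (𝓞 K) := Module.finBasisOfFinrankEq ℤ (𝓞 K) hr
  obtain ⟨x, y, hxy⟩ : ∃ x y : ℤ, (1 : 𝓞 K) = x * b 0 + y * b 1 := by
    have := b.sum_repr 1
    rw [Fin.sum_univ_two, zsmul_eq_mul, zsmul_eq_mul] at this
    exact ⟨b.repr 1 0, b.repr 1 1, this.symm⟩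
  have hb : ∀ p q : ℤ, (p : 𝓞 K) * b 0 + q * b 1 = 0 → p = 0 ∧ q = 0 := by
    intro p q h
    have := Fintype.linearIndependent_iff.1 b.linearIndependent ![p, q]
      (by simpa [Fin.sum_univ_two, zsmul_eq_mul] using h)
    exact ⟨this 0, this 1⟩
  -- A common divisor of the coordinates of 1 would be a unit, so the vector of coordinates is
  -- primitive and extends to a basis.
  have hcop : IsCoprime x y := by
    rw [Int.isCoprime_iff_gcd_eq_one]
    obtain ⟨x', hx'⟩ := Int.gcd_dvd_left x y
    obtain ⟨y', hy'⟩ := Int.gcd_dvd_right x y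
    set g := Int.gcd x y
    have h1 : (algebraMap ℤ (𝓞 K) (g : ℤ)) * (x' * b 0 + y' * b 1) = 1 := by
      rw [hxy, hx', hy']; simp; ring
    have h2 : IsUnit (algebraMap ℤ (𝓞 K) (g : ℤ)) := IsUnit.of_mul_eq_one _ h1
    have h3 := h2.map (Algebra.norm ℤ)
    rw [Algebra.norm_algebraMap, isUnit_pow_iff (Module.finrank_pos).ne', Int.isUnit_iff] at h3
    omega
  obtain ⟨u, v, huv⟩ := hcop
  set ω : 𝓞 K := -v * b 0 + u * b 1 with hω
  have huv' : (u : 𝓞 K) * x + v * y = 1 := by exact_mod_cast congrArg (Int.cast (R := 𝓞 K)) huv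
  have hspan : ∀ z : 𝓞 K, ∃ p q : ℤ, z = p + q * ω := by
    intro z
    have hz := b.sum_repr z
    rw [Fin.sum_univ_two, zsmul_eq_mul, zsmul_eq_mul] at hz
    refine ⟨b.repr z 0 * u + b.repr z 1 * v, - b.repr z 0 * y + b.repr z 1 * x, ?_⟩
    push_cast
    rw [hω]
    linear_combination -hz - (b.repr z 0 * b 0 + b.repr z 1 * b 1) * huv' -
      ((b.repr z 0 : 𝓞 K) * u + b.repr z 1 * v) * hxy
  have hind : ∀ p q : ℤ, (p : 𝓞 K) + q * ω = 0 → p = 0 ∧ q = 0 := by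
    intro p q h
    obtain ⟨h1, h2⟩ := hb (p * x - q * v) (p * y + q * u) (by
      push_cast; rw [hω] at h; linear_combination h - p * hxy)
    have e1 : p = 0 := by linear_combination u * h1 + v * h2 - p * huv
    refine ⟨e1, ?_⟩
    subst e1
    linear_combination x * h2 - y * h1 - q * huv
  obtain ⟨n', t, hn⟩ := hspan (ω * ω)
  have hQ : IsQuadBasis ω t (-n') := ⟨by rw [hn]; push_cast; ring, hspan, hind⟩
  refine ⟨ω, t, -n', hQ, ?_⟩
  have hli : LinearIndependent ℤ ![(1 : 𝓞 K), ω] := by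
    rw [Fintype.linearIndependent_iff]
    intro g hg i
    rw [Fin.sum_univ_two] at hg
    have := hind (g 0) (g 1) (by simpa [zsmul_eq_mul] using hg)
    fin_cases i
    · exact this.1
    · exact this.2
  have hsp : ⊤ ≤ Submodule.span ℤ (Set.range ![(1 : 𝓞 K), ω]) := by
    rintro z -
    obtain ⟨p, q, rfl⟩ := hspan z
    rw [Matrix.range_cons, Matrix.range_cons, Matrix.range_empty, Set.union_empty]
    refine add_mem ?_ ?_
    · have : (p : 𝓞 K) = p • (1 : 𝓞 K) := by simp
      rw [this]
      exact Submodule.smul_mem _ _ (Submodule.subset_span (by simp))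
    · rw [← zsmul_eq_mul]
      exact Submodule.smul_mem _ _ (Submodule.subset_span (by simp))
  let B : Module.Basis (Fin 2) ℤ (𝓞 K) := Module.Basis.mk hli hsp
  have hB : ⇑B = ![(1 : 𝓞 K), ω] := Module.Basis.coe_mk hli hsp
  have hB0 : B 0 = 1 := by rw [hB]; rfl
  have hB1 : B 1 = ω := by rw [hB]; rfl
  have hrepr : ∀ p q : ℤ, B.repr ((p : 𝓞 K) + q * ω) 0 = p ∧ B.repr ((p : 𝓞 K) + q * ω) 1 = q := by
    intro p q
    have : (p : 𝓞 K) + q * ω = p • B 0 + q • B 1 := by rw [hB0, hB1]; simp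
    rw [this, map_add, map_smul, map_smul, B.repr_self, B.repr_self]
    simp
  have htr : ∀ p q : ℤ, Algebra.trace ℤ (𝓞 K) ((p : 𝓞 K) + q * ω) = 2 * p + q * t := by
    intro p q
    rw [Algebra.trace_eq_matrix_trace B, Matrix.trace_fin_two, Algebra.leftMulMatrix_eq_repr_mul,
      Algebra.leftMulMatrix_eq_repr_mul, hB0, hB1, mul_one, (hrepr p q).1]
    have : ((p : 𝓞 K) + q * ω) * ω = ((q * n' : ℤ) : 𝓞 K) + ((p + q * t : ℤ) : 𝓞 K) * ω := by
      push_cast; linear_combination (q : 𝓞 K) * hn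
    rw [this, (hrepr _ _).2]
    ring
  rw [← NumberField.discr_eq_discr K B, Algebra.discr_def, Matrix.det_fin_two]
  simp only [Algebra.traceMatrix_apply, Algebra.traceForm_apply, hB0, hB1, mul_one, one_mul]
  have h1 := htr 1 0
  have h2 := htr 0 1
  have h3 := htr n' t
  rw [← hn] at h3
  simp only [Int.cast_one, Int.cast_zero, zero_mul, add_zero, zero_add, one_mul] at h1 h2
  rw [h1, h2, h3]
  ring

theorem discr_le_neg_three (K : Type*) [Field K] [NumberField K] (hK : Module.finrank ℚ K = 2)
    [IsTotallyComplex K] : discr K ≤ -3 := by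
  have h1 := abs_discr_gt_two (K := K) (by omega)
  have h2 := sign_discr K
  have h3 := IsTotallyComplex.finrank K
  have h4 : InfinitePlace.nrComplexPlaces K = 1 := by omega
  rw [h4, pow_one] at h2
  have h5 : discr K < 0 := Int.sign_eq_neg_one_iff_neg.1 h2
  rw [abs_of_neg h5] at h1
  omega

theorem not_ramifiedIn_of_splitIn {K : Type*} [Field K] [NumberField K] {ℓ : ℕ} (hℓ : ℓ.Prime)
    (h : SplitIn K ℓ) : ¬ RamifiedIn K ℓ := by
  rintro ⟨R, hR, hR2⟩
  obtain ⟨P, Q, hP, hQ, hne, hPQ⟩ := h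
  have h0 : Ideal.span {(ℓ : 𝓞 K)} ≠ ⊥ := by
    rw [Ne, Ideal.span_singleton_eq_bot]
    exact Nat.cast_ne_zero.2 hℓ.ne_zero
  have hRm : R.IsMaximal := by
    refine hR.isMaximal (by rintro rfl; rw [hR2] at h0; simp at h0)
  have h1 : R ≤ P := hP.le_of_pow_le (I := R) (n := 2) (by rw [← hR2, hPQ]; exact Ideal.mul_le_left)
  have h2 : R ≤ Q := hQ.le_of_pow_le (I := R) (n := 2) (by rw [← hR2, hPQ]; exact Ideal.mul_le_right)
  exact hne ((hRm.eq_of_le hP.ne_top h1).symm.trans (hRm.eq_of_le hQ.ne_top h2))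

theorem not_ramifiedIn_of_inertIn {K : Type*} [Field K] [NumberField K] {ℓ : ℕ} (hℓ : ℓ.Prime)
    (h : InertIn K ℓ) : ¬ RamifiedIn K ℓ := by
  rintro ⟨R, hR, hR2⟩
  have h0 : Ideal.span {(ℓ : 𝓞 K)} ≠ ⊥ := by
    rw [Ne, Ideal.span_singleton_eq_bot]
    exact Nat.cast_ne_zero.2 hℓ.ne_zero
  have hR0 : R ≠ ⊥ := by rintro rfl; rw [hR2] at h0; simp at h0
  unfold InertIn at h
  have h1 : R ≤ Ideal.span {(ℓ : 𝓞 K)} := h.le_of_pow_le (n := 2) hR2.ge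
  have h2 : R ^ 2 = R := le_antisymm (Ideal.pow_le_self two_ne_zero) (by rwa [hR2] at h1)
  rw [sq] at h2
  have h3 : R * R = R * (1 : Ideal (𝓞 K)) := by rw [h2, mul_one]
  exact hR.ne_top ((mul_left_cancel₀ hR0 h3).trans Ideal.one_eq_top)

theorem IsQuadBasis.dvd_iff {C : Type*} [CommRing C] {η : C} {T N : ℤ} (h : IsQuadBasis η T N)
    (m a b : ℤ) : (m : C) ∣ a + b * η ↔ m ∣ a ∧ m ∣ b := by
  constructor
  · rintro ⟨z, hz⟩
    obtain ⟨x, y, rfl⟩ := h.span z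
    obtain ⟨h1, h2⟩ := h.ext (a' := m * x) (b' := m * y)
      (hz.trans (by push_cast; ring))
    exact ⟨⟨x, h1⟩, ⟨y, h2⟩⟩
  · rintro ⟨⟨x, rfl⟩, ⟨y, rfl⟩⟩
    exact ⟨x + y * η, by push_cast; ring⟩

/-- Modulo a prime dividing the discriminant there is a nilpotent element `η - r`. -/
theorem IsQuadBasis.exists_sq_dvd {C : Type*} [CommRing C] {η : C} {T N : ℤ}
    (h : IsQuadBasis η T N) {p : ℕ} (hp : p.Prime) (hD : (p : ℤ) ∣ T ^ 2 - 4 * N) :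
    ∃ r : ℤ, (p : C) ∣ (η - r) ^ 2 := by
  have key : ∀ r : ℤ, (p : ℤ) ∣ T - 2 * r → (p : ℤ) ∣ r ^ 2 - N → (p : C) ∣ (η - r) ^ 2 := by
    intro r h1 h2
    have e : (η - r) ^ 2 = ((r ^ 2 - N : ℤ) : C) + ((T - 2 * r : ℤ) : C) * η := by
      push_cast; linear_combination h.sq
    have := (h.dvd_iff (p : ℤ) (r ^ 2 - N) (T - 2 * r)).2 ⟨h2, h1⟩
    rw [e]
    exact_mod_cast this
  rcases hp.eq_two_or_odd' with rfl | hodd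
  -- For `p = 2`, `T` is even and `N² ≡ N`, so `N` is a double root of `X² - TX + N` modulo 2.
  · refine ⟨N, key N ?_ ?_⟩
    · have h1 : (2 : ℤ) ∣ T ^ 2 := by
        push_cast at hD
        obtain ⟨k, hk⟩ := hD
        exact ⟨k + 2 * N, by linarith⟩
      have h2 : (2 : ℤ) ∣ T := Int.prime_two.dvd_of_dvd_pow h1
      push_cast
      exact dvd_sub h2 (dvd_mul_right _ _)
    · push_cast
      rw [show N ^ 2 - N = N * (N - 1) by ring]
      exact (Int.even_mul_pred_self N).two_dvd
  · obtain ⟨k, hk⟩ := hodd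
    -- With `p = 2k + 1`, the integer `k + 1` is the inverse of 2 modulo `p`, so this is the double
    -- root `T/2`.
    refine ⟨(k + 1) * T, key _ ⟨-T, by rw [hk]; push_cast; ring⟩ ?_⟩
    have hc : IsCoprime (p : ℤ) 4 := ⟨p, -(k ^ 2 + k), by rw [hk]; push_cast; ring⟩
    apply hc.dvd_of_dvd_mul_left
    have : (4 : ℤ) * (((k + 1) * T) ^ 2 - N) = (T ^ 2 - 4 * N) + p * (p + 2) * T ^ 2 := by
      rw [hk]; push_cast; ring
    rw [this]
    exact dvd_add hD ⟨_, mul_assoc _ _ _⟩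

/-- If `(ℓ) = P²`, an element of `P` outside `(ℓ)` is nilpotent modulo `ℓ`, which forces `ℓ ∣ D`.
Conversely, `ω - r` is nilpotent modulo `ℓ`, so `(ℓ)` is not squarefree; its norm `ℓ²` leaves room
only for `P²`. -/
theorem ramifiedIn_iff {K : Type*} [Field K] [NumberField K] (hK : Module.finrank ℚ K = 2) {ℓ : ℕ}
    (hℓ : ℓ.Prime) : RamifiedIn K ℓ ↔ (ℓ : ℤ) ∣ discr K := by
  obtain ⟨ω, t, n, hQ, hD⟩ := exists_isQuadBasis K hK
  have hpi : Prime (ℓ : ℤ) := Nat.prime_iff_prime_int.1 hℓ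
  have h0 : (ℓ : 𝓞 K) ≠ 0 := Nat.cast_ne_zero.2 hℓ.ne_zero
  constructor
  · rintro ⟨P, hP, hP2⟩
    have hPne : ¬ P ≤ Ideal.span {(ℓ : 𝓞 K)} := by
      intro hle
      have hP0 : P ≠ ⊥ := by
        rintro rfl
        have := Ideal.mem_span_singleton_self (ℓ : 𝓞 K)
        rw [hP2] at this
        simp at this
        exact h0 (by exact_mod_cast this)
      have h2 : P * P = P * (1 : Ideal (𝓞 K)) := by
        rw [mul_one, ← sq]
        exact le_antisymm (Ideal.pow_le_self two_ne_zero) (by rwa [hP2] at hle)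
      exact hP.ne_top ((mul_left_cancel₀ hP0 h2).trans Ideal.one_eq_top)
    obtain ⟨x, hx, hx'⟩ := SetLike.not_le_iff_exists.1 hPne
    have hx2 : (ℓ : 𝓞 K) ∣ x ^ 2 := by
      rw [← Ideal.mem_span_singleton, hP2]
      exact Ideal.pow_mem_pow hx 2
    rw [Ideal.mem_span_singleton] at hx'
    obtain ⟨a, b, rfl⟩ := hQ.span x
    have e : ((a : 𝓞 K) + b * ω) ^ 2 = ((a ^ 2 - b ^ 2 * n : ℤ) : 𝓞 K) +
        ((b * (2 * a + b * t) : ℤ) : 𝓞 K) * ω := by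
      push_cast; linear_combination (b : 𝓞 K) ^ 2 * hQ.sq
    rw [e] at hx2
    obtain ⟨h1, h2⟩ := (hQ.dvd_iff (ℓ : ℤ) _ _).1 (by exact_mod_cast hx2)
    have hb : ¬ (ℓ : ℤ) ∣ b := by
      intro hb
      apply hx'
      have : (ℓ : ℤ) ∣ a := by
        apply hpi.dvd_of_dvd_pow (n := 2)
        have h3 := dvd_add h1 ((hb.mul_left b).mul_right n)
        rwa [show a ^ 2 - b ^ 2 * n + b * b * n = a ^ 2 by ring] at h3
      exact_mod_cast (hQ.dvd_iff (ℓ : ℤ) _ _).2 ⟨this, hb⟩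
    have h3 := (hpi.dvd_or_dvd h2).resolve_left hb
    have h4 : (ℓ : ℤ) ∣ b ^ 2 * discr K := by
      rw [hD, show b ^ 2 * (t ^ 2 - 4 * n) =
        4 * (a ^ 2 - b ^ 2 * n) + (2 * a + b * t) * (b * t - 2 * a) by ring]
      exact dvd_add (h1.mul_left _) (h3.mul_right _)
    exact (hpi.dvd_or_dvd h4).resolve_left fun h5 => hb (hpi.dvd_of_dvd_pow h5)
  · intro hdvd
    rw [hD] at hdvd
    obtain ⟨r, hr⟩ := hQ.exists_sq_dvd hℓ hdvd
    set I := Ideal.span {(ℓ : 𝓞 K)} with hI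
    have hI0 : I ≠ ⊥ := by rwa [hI, Ne, Ideal.span_singleton_eq_bot]
    have hnorm : Ideal.absNorm I = ℓ ^ 2 := by
      rw [hI, Ideal.absNorm_span_singleton, show (ℓ : 𝓞 K) = algebraMap ℤ (𝓞 K) ℓ by simp,
        Algebra.norm_algebraMap, RingOfIntegers.rank, hK, Int.natAbs_pow, Int.natAbs_natCast]
    have hrad : ¬ Squarefree I := by
      intro hsq
      have h1 : I ∣ Ideal.span {ω - (r : 𝓞 K)} ^ 2 := by
        rw [Ideal.span_singleton_pow, Ideal.dvd_span_singleton, hI, Ideal.mem_span_singleton]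
        exact hr
      have h2 := hsq.isRadical 2 _ h1
      rw [Ideal.dvd_span_singleton, hI, Ideal.mem_span_singleton] at h2
      have h3 : ((ℓ : ℤ) : 𝓞 K) ∣ ((-r : ℤ) : 𝓞 K) + ((1 : ℤ) : 𝓞 K) * ω := by
        push_cast; rwa [one_mul, neg_add_eq_sub]
      exact hpi.not_isUnit (isUnit_of_dvd_one ((hQ.dvd_iff _ _ _).1 h3).2)
    simp only [Squarefree, not_forall] at hrad
    obtain ⟨P, ⟨Q, hPQ⟩, hPu⟩ := hrad
    rw [Ideal.isUnit_iff, ← Ideal.absNorm_eq_one_iff] at hPu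
    have h1 := hnorm
    rw [hPQ, map_mul, map_mul] at h1
    obtain ⟨i, hi, hPi⟩ := (Nat.dvd_prime_pow hℓ).1
      (show Ideal.absNorm P ∣ ℓ ^ 2 from ⟨_, by rw [← h1, mul_assoc]⟩)
    have hPl : Ideal.absNorm P = ℓ := by
      interval_cases i
      · exact absurd (by simpa using hPi) hPu
      · simpa using hPi
      · exfalso
        rw [hPi] at h1
        have h3 : ℓ ^ 2 * ℓ ^ 2 ∣ ℓ ^ 2 * 1 := ⟨_, by rw [mul_one]; exact h1.symm⟩
        have h4 := (Nat.mul_dvd_mul_iff_left (pow_pos hℓ.pos 2)).1 h3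
        have := Nat.eq_one_of_dvd_one h4
        have := hℓ.two_le
        nlinarith
    have hQ1 : Q = 1 := by
      rw [Ideal.one_eq_top, ← Ideal.absNorm_eq_one_iff]
      rw [hPl, ← sq] at h1
      exact Nat.eq_of_mul_eq_mul_left (pow_pos hℓ.pos 2) (by rw [h1, mul_one])
    refine ⟨P, Ideal.isPrime_of_irreducible_absNorm (by rw [hPl]; exact hℓ), ?_⟩
    rw [← hI, hPQ, hQ1, mul_one, sq]

/-! ### Compatible isomorphisms for towers of finite groups. -/

/-- The homomorphism `ℤ/m → G` with `1 ↦ g`. -/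
def zmodHom {G : Type*} [CommGroup G] (m : ℕ) (g : G) (hg : g ^ m = 1) : ZMod m →+ Additive G :=
  ZMod.lift m ⟨zmultiplesHom (Additive G) (Additive.ofMul g), by
    rw [zmultiplesHom_apply, natCast_zsmul, ← ofMul_pow, hg, ofMul_one]⟩

theorem zmodHom_intCast {G : Type*} [CommGroup G] {m : ℕ} {g : G} (hg : g ^ m = 1) (i : ℤ) :
    zmodHom m g hg i = Additive.ofMul (g ^ i) := by
  unfold zmodHom
  rw [ZMod.lift_coe, zmultiplesHom_apply, ofMul_zpow]

/-- Compatible elements whose orders equal the group orders are generators; sending 1 to them gives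
isomorphisms that commute with the maps. The exponent `f` is left free to serve both cyclic cases.
-/
theorem exists_equiv_tower {ℓ : ℕ} [NeZero ℓ] {G : ℕ → Type*} [∀ n, CommGroup (G n)]
    (π : ∀ n, G (n + 1) →* G n) (f : ℕ → ℕ) (g : ∀ n, G n) (hg : ∀ n, π n (g (n + 1)) = g n)
    (hcard : ∀ n, Nat.card (G n) = ℓ ^ f n) (hord : ∀ n, orderOf (g n) = ℓ ^ f n) :
    ∃ e : ∀ n, Additive (G n) ≃+ ZMod (ℓ ^ f n), ∀ n (hd : ℓ ^ f n ∣ ℓ ^ f (n + 1)) (x : G (n + 1)),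
      e n (Additive.ofMul (π n x)) =
        ZMod.castHom hd (ZMod (ℓ ^ f n)) (e (n + 1) (Additive.ofMul x)) := by
  have hg1 : ∀ n, g n ^ ℓ ^ f n = 1 := fun n => by rw [← hord]; exact pow_orderOf_eq_one _
  have hbij : ∀ n, Function.Bijective (zmodHom (ℓ ^ f n) (g n) (hg1 n)) := by
    intro n
    have : Finite (G n) := Nat.finite_of_card_ne_zero
      (by rw [hcard]; exact pow_ne_zero _ (NeZero.ne ℓ))
    have : Finite (Additive (G n)) := this
    have : NeZero (ℓ ^ f n) := ⟨pow_ne_zero _ (NeZero.ne ℓ)⟩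
    rw [Nat.bijective_iff_injective_and_card]
    refine ⟨?_, by rw [Nat.card_zmod]; exact (hcard n).symm⟩
    rw [injective_iff_map_eq_zero]
    intro a ha
    obtain ⟨i, rfl⟩ := ZMod.intCast_surjective a
    rw [zmodHom_intCast, ofMul_eq_zero, ← orderOf_dvd_iff_zpow_eq_one, hord] at ha
    exact (ZMod.intCast_zmod_eq_zero_iff_dvd _ _).2 ha
  let E := fun n => AddEquiv.ofBijective _ (hbij n)
  refine ⟨fun n => (E n).symm, fun n hd x => ?_⟩
  obtain ⟨a, ha⟩ := (hbij (n + 1)).2 (Additive.ofMul x)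
  have hE : (E (n + 1)).symm (Additive.ofMul x) = a := (AddEquiv.symm_apply_eq _).2 ha.symm
  beta_reduce
  rw [hE, AddEquiv.symm_apply_eq]
  change _ = zmodHom (ℓ ^ f n) (g n) (hg1 n) _
  obtain ⟨i, rfl⟩ := ZMod.intCast_surjective a
  rw [zmodHom_intCast] at ha
  rw [map_intCast, zmodHom_intCast, ← Additive.ofMul.injective ha, map_zpow, hg]

/-- Independence of `g n` and `t n` makes `ℤ/ℓ^n × ℤ/ℓ → G n` injective, and the cardinality makes
it bijective. -/
theorem exists_equiv_tower_prod {ℓ : ℕ} [NeZero ℓ] {G : ℕ → Type*} [∀ n, CommGroup (G n)]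
    (π : ∀ n, G (n + 1) →* G n) (g t : ∀ n, G n) (hg : ∀ n, π n (g (n + 1)) = g n)
    (ht : ∀ n, π n (t (n + 1)) = t n) (hcard : ∀ n, Nat.card (G n) = ℓ ^ (n + 1))
    (hg1 : ∀ n, g n ^ ℓ ^ n = 1) (ht1 : ∀ n, t n ^ ℓ = 1)
    (hind : ∀ n (i j : ℤ), g n ^ i * t n ^ j = 1 → (ℓ : ℤ) ^ n ∣ i ∧ (ℓ : ℤ) ∣ j) :
    ∃ e : ∀ n, Additive (G n) ≃+ ZMod (ℓ ^ n) × ZMod ℓ, ∀ n (x : G (n + 1)),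
      e n (Additive.ofMul (π n x)) =
        Prod.map (canProj ℓ n) id (e (n + 1) (Additive.ofMul x)) := by
  let F : ∀ n, ZMod (ℓ ^ n) × ZMod ℓ →+ Additive (G n) := fun n =>
    (zmodHom (ℓ ^ n) (g n) (hg1 n)).coprod (zmodHom ℓ (t n) (ht1 n))
  have hF : ∀ n (i j : ℤ), F n (i, j) = Additive.ofMul (g n ^ i * t n ^ j) := by
    intro n i j
    rw [AddMonoidHom.coprod_apply, zmodHom_intCast, zmodHom_intCast, ofMul_mul]
  have hbij : ∀ n, Function.Bijective (F n) := by
    intro n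
    have : Finite (G n) := Nat.finite_of_card_ne_zero
      (by rw [hcard]; exact pow_ne_zero _ (NeZero.ne ℓ))
    have : Finite (Additive (G n)) := this
    have : NeZero (ℓ ^ n) := ⟨pow_ne_zero _ (NeZero.ne ℓ)⟩
    rw [Nat.bijective_iff_injective_and_card]
    refine ⟨?_, by rw [Nat.card_prod, Nat.card_zmod, Nat.card_zmod]; exact (hcard n).symm⟩
    rw [injective_iff_map_eq_zero]
    rintro ⟨a, b⟩ ha
    obtain ⟨i, rfl⟩ := ZMod.intCast_surjective a
    obtain ⟨j, rfl⟩ := ZMod.intCast_surjective b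
    rw [hF, ofMul_eq_zero] at ha
    obtain ⟨h1, h2⟩ := hind n i j ha
    rw [Prod.mk_eq_zero, ZMod.intCast_zmod_eq_zero_iff_dvd, ZMod.intCast_zmod_eq_zero_iff_dvd]
    exact ⟨by exact_mod_cast h1, h2⟩
  let E := fun n => AddEquiv.ofBijective _ (hbij n)
  refine ⟨fun n => (E n).symm, fun n x => ?_⟩
  obtain ⟨⟨a, b⟩, ha⟩ := (hbij (n + 1)).2 (Additive.ofMul x)
  have hE : (E (n + 1)).symm (Additive.ofMul x) = (a, b) := (AddEquiv.symm_apply_eq _).2 ha.symm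
  beta_reduce
  rw [hE, AddEquiv.symm_apply_eq]
  change _ = F n _
  obtain ⟨i, rfl⟩ := ZMod.intCast_surjective a
  obtain ⟨j, rfl⟩ := ZMod.intCast_surjective b
  rw [hF] at ha
  have hc : canProj ℓ n ((i : ℤ) : ZMod (ℓ ^ (n + 1))) = (i : ZMod (ℓ ^ n)) :=
    map_intCast (ZMod.castHom (pow_dvd_pow ℓ (Nat.le_succ n)) (ZMod (ℓ ^ n))) i
  rw [Prod.map_apply, hc, id, hF, ← Additive.ofMul.injective ha, map_mul, map_zpow, map_zpow, hg, ht]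

theorem nonempty_equiv_zmod_of_card {G : Type*} [CommGroup G] {ℓ : ℕ} (hℓ : ℓ.Prime) {g : G}
    (hg : g ^ ℓ = 1) (hg1 : g ≠ 1) (h : ∀ x, x ∈ Subgroup.zpowers g) :
    Nat.card G = ℓ ∧ Nonempty (Additive G ≃+ ZMod ℓ) := by
  have ho : orderOf g = ℓ := by
    have := Fact.mk hℓ
    exact orderOf_eq_prime hg hg1
  have hc : Nat.card G = ℓ := by rw [← ho, orderOf_eq_card_of_forall_mem_zpowers h]
  refine ⟨hc, ?_⟩
  have : NeZero ℓ := ⟨hℓ.ne_zero⟩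
  obtain ⟨e, -⟩ := exists_equiv_tower (ℓ := ℓ) (G := fun _ => G) (fun _ => MonoidHom.id G)
    (fun _ => 1) (fun _ => g) (fun _ => rfl) (fun _ => by rw [hc, pow_one])
    (fun _ => by rw [ho, pow_one])
  exact ⟨(e 0).trans (ZMod.ringEquivCongr (pow_one ℓ)).toAddEquiv⟩

/-! ### Arithmetic modulo `ℓ`: the separable case and the elements `1 + ℓ^d (η - r)`. -/

theorem exists_one_add_pow_eq {C : Type*} [CommRing C] (y : C) (j : ℕ) :
    ∃ z : C, (1 + y) ^ j = 1 + j * y + y ^ 2 * z := by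
  induction j with
  | zero => exact ⟨0, by simp⟩
  | succ j ih =>
    obtain ⟨z, hz⟩ := ih
    exact ⟨j + z + y * z, by rw [pow_succ, hz]; push_cast; ring⟩

theorem isCoprime_one_add {C : Type*} [CommRing C] {p y : C} (h : p ∣ y ^ 2) :
    IsCoprime (1 + y) p := by
  obtain ⟨k, hk⟩ := h
  exact ⟨1 - y, k, by linear_combination -hk⟩

theorem isCoprime_intCast {C : Type*} [CommRing C] {p : ℕ} (hp : p.Prime) {m : ℤ}
    (hm : ¬ (p : ℤ) ∣ m) : IsCoprime (m : C) p := by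
  obtain ⟨n, k, hk⟩ := exists_mul_sub_one_of_not_dvd (C := C) hp 1 m hm
  exact ⟨n, -k, by linear_combination hk⟩

theorem intCast_pow_char_sq {Q : Type*} [CommRing Q] (p : ℕ) [Fact p.Prime] [CharP Q p] (a : ℤ) :
    (a : Q) ^ p ^ 2 = a := by
  have h1 : ((a : ℤ) : Q) = ZMod.castHom (dvd_refl p) Q (a : ZMod p) := by simp
  rw [h1, ← map_pow, ZMod.pow_card_pow]

/-- A root of a separable quadratic polynomial over `𝔽_p` is fixed by the square of Frobenius. -/
theorem pow_char_sq_eq_self {Q : Type*} [CommRing Q] {p : ℕ} [hp : Fact p.Prime] [CharP Q p]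
    {T N : ℤ} (hD : ¬ (p : ℤ) ∣ T ^ 2 - 4 * N) {x : Q} (hsq : x * x = T * x - N) :
    x ^ p ^ 2 = x := by
  have h0 : ((p : ℕ) : Q) = 0 := CharP.cast_eq_zero Q p
  rcases hp.out.eq_two_or_odd' with rfl | hodd
  · have h2 : (2 : Q) = 0 := by exact_mod_cast h0
    have hT : Odd T := by
      rw [← Int.not_even_iff_odd]
      rintro ⟨k, hk⟩
      exact hD ⟨2 * k ^ 2 - 2 * N, by rw [hk]; push_cast; ring⟩
    obtain ⟨k, rfl⟩ := hT
    obtain ⟨l, hl⟩ := (Int.even_mul_succ_self N).two_dvd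
    have hl' := congrArg (Int.cast (R := Q)) hl
    push_cast at hl' hsq
    have e1 : x ^ 2 = x + N := by linear_combination hsq + (k * x - N) * h2
    have e2 : x ^ 4 = x := by
      linear_combination (x ^ 2 + x + N + 1) * e1 + (N * x + l) * h2 + hl'
    exact e2
  · obtain ⟨s, hs⟩ : ∃ s : Q, s = 2 * x - T := ⟨_, rfl⟩
    have hs2 : s ^ 2 = ((T ^ 2 - 4 * N : ℤ) : Q) := by
      push_cast; rw [hs]; linear_combination 4 * hsq
    have hsp : s ^ p ^ 2 = s := by
      obtain ⟨k, hk⟩ := hodd.pow (n := 2)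
      have hz : ((T ^ 2 - 4 * N : ℤ) : ZMod p) ≠ 0 := by
        rwa [Ne, ZMod.intCast_zmod_eq_zero_iff_dvd]
      -- Here `k = (p² - 1)/2` is a multiple of `p - 1`, so Fermat applies to `s² = T² - 4N`.
      have hk' : k = (p - 1) * ((p + 1) / 2) := by
        obtain ⟨q, rfl⟩ := hodd
        rw [Nat.add_sub_cancel, show (2 * q + 1 + 1) / 2 = q + 1 by omega]
        nlinarith
      have h1 : ((T ^ 2 - 4 * N : ℤ) : ZMod p) ^ k = 1 := by
        rw [hk', pow_mul, ZMod.pow_card_sub_one_eq_one hz, one_pow]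
      have h2 : ((T ^ 2 - 4 * N : ℤ) : Q) ^ k = 1 := by
        have h3 := congrArg (ZMod.castHom (dvd_refl p) Q) h1
        rwa [map_pow, map_intCast, map_one] at h3
      rw [hk, pow_succ, pow_mul, hs2, h2, one_mul]
    have h2x : 2 * x = s + T := by rw [hs]; ring
    have h2 : (2 : Q) ^ p ^ 2 = 2 := by exact_mod_cast intCast_pow_char_sq (Q := Q) p 2
    have e1 : (2 * x) ^ p ^ 2 = 2 * x := by
      rw [h2x, add_pow_char_pow, hsp, intCast_pow_char_sq]
    rw [mul_pow, h2] at e1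
    obtain ⟨k, hk⟩ := hodd
    have h0' := congrArg (Nat.cast (R := Q)) hk
    rw [h0] at h0'
    push_cast at h0'
    linear_combination (-(x ^ p ^ 2 - x)) * h0' - k * e1

/-- The quotient by `p` is `𝔽_p × 𝔽_p` or `𝔽_{p²}`; the exponent `p²` treats both at once. -/
theorem IsQuadBasis.pow_sq_sub_self_dvd {C : Type*} [CommRing C] {η : C} {T N : ℤ}
    (h : IsQuadBasis η T N) {p : ℕ} (hp : p.Prime) (hD : ¬ (p : ℤ) ∣ T ^ 2 - 4 * N) (u : C) :
    (p : C) ∣ u ^ p ^ 2 - u := by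
  have := Fact.mk hp
  have hdvd : ∀ x : C, (p : C) ∣ x ↔ (Ideal.Quotient.mk (Ideal.span {(p : C)}) x) = 0 := fun x => by
    rw [Ideal.Quotient.eq_zero_iff_mem, Ideal.mem_span_singleton]
  have hchar : CharP (C ⧸ Ideal.span {(p : C)}) p := by
    refine ⟨fun n => ?_⟩
    rw [← map_natCast (Ideal.Quotient.mk (Ideal.span {(p : C)})), ← hdvd]
    have := h.dvd_iff (p : ℤ) n 0
    simp only [Int.cast_natCast, Int.cast_zero, zero_mul, add_zero, dvd_zero, and_true] at this
    rw [this]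
    exact Int.natCast_dvd_natCast
  rw [hdvd, map_sub, map_pow, sub_eq_zero]
  obtain ⟨a, b, rfl⟩ := h.span u
  have hx2 := pow_char_sq_eq_self hD (x := Ideal.Quotient.mk (Ideal.span {(p : C)}) η)
    (by rw [← map_mul, h.sq, map_sub, map_mul, map_intCast, map_intCast])
  rw [map_add, map_mul, map_intCast, map_intCast, add_pow_char_pow, mul_pow, intCast_pow_char_sq,
    intCast_pow_char_sq, hx2]

theorem level_one {C : Type*} [CommRing C] (p e : ℕ) : Level p e (1 : C) := ⟨1, 0, by simp⟩

theorem level_one_add {C : Type*} [CommRing C] {p d : ℕ} {η : C} {r : ℤ} :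
    Level p d (1 + p ^ d * (η - r)) := ⟨1, η - r, by push_cast; rfl⟩

theorem level_one_add_pow {C : Type*} [CommRing C] {p d : ℕ} {η : C} {r : ℤ}
    (hr : (p : C) ^ (d + 1) ∣ (p ^ d * (η - r)) ^ 2) :
    Level p (d + 1) ((1 + p ^ d * (η - r)) ^ p) := by
  obtain ⟨z, hz⟩ := exists_one_add_pow_eq (p ^ d * (η - r)) p
  obtain ⟨w, hw⟩ := hr
  refine ⟨1, (η - r) + w * z, ?_⟩
  rw [hz, hw]; push_cast; ring

theorem IsQuadBasis.not_level_one_add {C : Type*} [CommRing C] {η : C} {T N : ℤ}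
    (h : IsQuadBasis η T N) {p d : ℕ} (hp : p.Prime) (r : ℤ) :
    ¬ Level p (d + 1) (1 + p ^ d * (η - r)) := by
  have e : 1 + p ^ d * (η - r) = ((1 - p ^ d * r : ℤ) : C) + ((p ^ d : ℤ) : C) * η := by
    push_cast; ring
  rw [e, h.level_iff]
  intro h2
  have h3 := (Nat.pow_dvd_pow_iff_le_right hp.one_lt).1 (by exact_mod_cast h2)
  omega

/-- Put `y = p^d (η - r)`. Modulo `p^(d+1)` one has `y² ≡ 0`, so `(1 + y)^j ≡ 1 + j y`, while `a =
m' + b y` with `m'` prime to `p`. It remains to take `j ≡ b/m'` modulo `p`. The hypothesis `hr`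
covers both `d ≥ 1` with any `r` and the ramified case `d = 0`. -/
theorem IsQuadBasis.exists_one_add_pow_mul_sub_dvd {C : Type*} [CommRing C] {η : C} {T N : ℤ}
    (h : IsQuadBasis η T N) {p d : ℕ} (hp : p.Prime) {r : ℤ} {a : C}
    (hr : (p : C) ^ (d + 1) ∣ (p ^ d * (η - r)) ^ 2) (ha : IsCoprime a (p : C))
    (hl : Level p d a) : ∃ (j : ℕ) (m : ℤ), ¬ (p : ℤ) ∣ m ∧
      (p : C) ^ (d + 1) ∣ (1 + p ^ d * (η - r)) ^ j * m - a := by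
  obtain ⟨m, b, hab⟩ := h.span a
  obtain ⟨b, rfl⟩ := (h.level_iff p d m b).1 (hab ▸ hl)
  have hab' : a = ((m + p ^ d * b * r : ℤ) : C) + b * (p ^ d * (η - r)) := by
    rw [hab]; push_cast; ring
  generalize m + p ^ d * b * r = m' at hab'
  have hm'l : ¬ (p : ℤ) ∣ m' := by
    rintro ⟨k, hk⟩
    have h3 : (p : C) ∣ a ^ 2 := by
      have e3 : a ^ 2 = p * (p * k ^ 2 + 2 * k * b * (p ^ d * (η - r))) +
          (p ^ d * (η - r)) ^ 2 * b ^ 2 := by rw [hab', hk]; push_cast; ring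
      rw [e3]
      exact dvd_add (dvd_mul_right _ _)
        (((dvd_pow_self _ (Nat.succ_ne_zero d)).trans hr).mul_right _)
    exact h.not_isUnit hp
      (isCoprime_self.1 ((ha.pow_left (m := 2)).of_isCoprime_of_dvd_left h3))
  obtain ⟨n, k, hk⟩ := exists_mul_sub_one_of_not_dvd (C := ℤ) hp 1 m' hm'l
  simp only [Int.cast_id, pow_one] at hk
  have hl0 : (p : ℤ) ≠ 0 := by exact_mod_cast hp.ne_zero
  obtain ⟨j, hj⟩ := Int.eq_ofNat_of_zero_le (Int.emod_nonneg (n * b) hl0)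
  obtain ⟨z, hz⟩ := exists_one_add_pow_eq (p ^ d * (η - r)) j
  have hnb : n * b = p * (n * b / p) + j := by rw [← hj]; exact (Int.mul_ediv_add_emod _ _).symm
  generalize n * b / p = q at hnb
  refine ⟨j, m', hm'l, ?_⟩
  obtain ⟨w, hw⟩ := hr
  have hk' := congrArg (Int.cast (R := C)) hk
  have hnb' := congrArg (Int.cast (R := C)) hnb
  push_cast at hk' hnb'
  refine ⟨(k * b - m' * q) * (η - r) + m' * w * z, ?_⟩
  rw [hab', hz, hw]
  linear_combination (b * (p ^ d * (η - r))) * hk' - m' * (p ^ d * (η - r)) * hnb'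

/-! ### The groups `κ_d`: elements, surjectivity, kernels and cardinalities. -/

section Kappa

variable {K : Type*} [Field K] {ℓ c : ℕ}

theorem kappa_ext {d : ℕ} {x y : kappa K ℓ c d} (h : x.1.1 = y.1.1) : x = y :=
  Subtype.ext (Subtype.ext h)

theorem kappa_zero : kappa K ℓ c 0 = ⊥ := by
  rw [eq_bot_iff]
  intro x hx
  rw [Subgroup.mem_bot]
  apply Subtype.ext
  have : subringClassMap _ x.1 = 1 := congrArg Subtype.val hx
  rwa [subringClassMap_self] at this

theorem exists_kappa {d : ℕ} (x : ClassGroup (quadOrder K (c * ℓ ^ d)))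
    (hx : subringClassMap (quadOrder_le_zero K ℓ c d) x = 1) {k : ℕ} (hk : x ^ ℓ ^ k = 1) :
    ∃ y : kappa K ℓ c d, y.1.1 = x :=
  ⟨⟨⟨x, k, hk⟩, Subtype.ext hx⟩, rfl⟩

theorem kappaMap_val {d : ℕ} (x : kappa K ℓ c (d + 1)) : (kappaMap K ℓ c d x).1.1 =
    subringClassMap (quadOrder_le K (mul_dvd_mul_left c (pow_dvd_pow ℓ (Nat.le_succ d)))) x.1.1 :=
  rfl

theorem kappa_exists_pow_eq_one {d : ℕ} (x : kappa K ℓ c d) : ∃ k : ℕ, x ^ ℓ ^ k = 1 := by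
  obtain ⟨k, hk⟩ := x.1.2
  exact ⟨k, kappa_ext hk⟩

variable [NumberField K] [Fact ℓ.Prime] [NeZero c]

instance neZero_of_fact_prime {p : ℕ} [h : Fact p.Prime] : NeZero p := ⟨h.out.ne_zero⟩

theorem kappa_exists_phi {d : ℕ} (x : kappa K ℓ c d) :
    ∃ u : quadOrder K (c * ℓ ^ 0), IsCoprime u (ℓ : quadOrder K (c * ℓ ^ 0)) ∧
      x.1.1 = phi K ℓ c d u :=
  exists_phi_of_classMap_eq_one d x.1.1 (congrArg Subtype.val x.2)

theorem phi_eq_one_of_level {d : ℕ} {u : quadOrder K (c * ℓ ^ 0)}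
    (hu : IsCoprime u (ℓ : quadOrder K (c * ℓ ^ 0))) (h : Level ℓ d u) : phi K ℓ c d u = 1 :=
  (phi_eq_one_iff d hu).2 ⟨1, u, h, by rw [Units.val_one, one_mul]⟩

/-- The elements prime to `ℓ` whose classes have `ℓ`-power order. -/
def IsProUnit {C : Type*} [CommRing C] (p : ℕ) (u : C) : Prop :=
  IsCoprime u (p : C) ∧ ∃ k : ℕ, Level p 1 (u ^ p ^ k)

theorem IsProUnit.exists_level {C : Type*} [CommRing C] {p : ℕ} (hp : p.Prime) {u : C}
    (hu : IsProUnit p u) (d : ℕ) : ∃ k : ℕ, Level p d (u ^ p ^ k) := by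
  obtain ⟨-, k, hk⟩ := hu
  have : ∀ j, Level p (1 + j) (u ^ p ^ (k + j)) := by
    intro j
    induction j with
    | zero => exact hk
    | succ j ih =>
      rw [← Nat.add_assoc, ← Nat.add_assoc, pow_succ p, pow_mul]
      exact ih.pow_prime hp (by omega)
  exact ⟨k + d, (this d).mono (by omega)⟩

theorem exists_kappa_phi (d : ℕ) {u : quadOrder K (c * ℓ ^ 0)} (hu : IsProUnit ℓ u) :
    ∃ y : kappa K ℓ c d, y.1.1 = phi K ℓ c d u := by
  obtain ⟨k, hk⟩ := hu.exists_level Fact.out d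
  refine exists_kappa _ (k := k) ?_ ?_
  · exact (classMap_phi (Nat.zero_le d) hu.1).trans
      (phi_eq_one_of_level hu.1 (level_zero ℓ u))
  · rw [← phi_pow d hu.1]
    exact phi_eq_one_of_level hu.1.pow_left hk

/-- The class of `u` as an element of `κ_d`. -/
def kappaOf (d : ℕ) (u : quadOrder K (c * ℓ ^ 0)) (hu : IsProUnit ℓ u) : kappa K ℓ c d :=
  (exists_kappa_phi d hu).choose

theorem kappaOf_val (d : ℕ) {u : quadOrder K (c * ℓ ^ 0)} (hu : IsProUnit ℓ u) :
    (kappaOf d u hu).1.1 = phi K ℓ c d u :=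
  (exists_kappa_phi d hu).choose_spec

theorem kappaMap_kappaOf (d : ℕ) {u : quadOrder K (c * ℓ ^ 0)} (hu : IsProUnit ℓ u) :
    kappaMap K ℓ c d (kappaOf (d + 1) u hu) = kappaOf d u hu := by
  apply kappa_ext
  rw [kappaMap_val, kappaOf_val, kappaOf_val]
  exact classMap_phi (Nat.le_succ d) hu.1

theorem kappaOf_pow_eq_one_iff (d : ℕ) {u : quadOrder K (c * ℓ ^ 0)} (hu : IsProUnit ℓ u) (n : ℕ) :
    kappaOf d u hu ^ n = 1 ↔ phi K ℓ c d (u ^ n) = 1 := by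
  rw [phi_pow d hu.1, ← kappaOf_val d hu]
  exact ⟨fun h => congrArg (fun x => x.1.1) h, fun h => kappa_ext h⟩

/-- The order of a class divides both a power of `ℓ` and `ℓ² - 1`, since `u^(ℓ²) ≡ u` modulo `ℓ`. -/
theorem kappa_one_eq_bot {η : quadOrder K (c * ℓ ^ 0)} {T N : ℤ} (h : IsQuadBasis η T N)
    (hD : ¬ (ℓ : ℤ) ∣ T ^ 2 - 4 * N) : kappa K ℓ c 1 = ⊥ := by
  have hp : ℓ.Prime := Fact.out
  rw [eq_bot_iff]
  intro x hx
  obtain ⟨u, hu, hxu⟩ := kappa_exists_phi (⟨x, hx⟩ : kappa K ℓ c 1)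
  have h1 : phi K ℓ c 1 u ^ ℓ ^ 2 = phi K ℓ c 1 u := by
    rw [← phi_pow 1 hu]
    refine phi_congr 1 hu.pow_left hu ?_
    rw [pow_one]
    exact h.pow_sq_sub_self_dvd hp hD u
  obtain ⟨k, hk⟩ := kappa_exists_pow_eq_one (⟨x, hx⟩ : kappa K ℓ c 1)
  have h2 : phi K ℓ c 1 u ^ ℓ ^ k = 1 := by
    rw [← hxu]; exact congrArg (fun x => x.1.1) hk
  have h3 : phi K ℓ c 1 u ^ (ℓ ^ 2 - 1) = 1 := by
    have : phi K ℓ c 1 u ^ (ℓ ^ 2 - 1) * phi K ℓ c 1 u = 1 * phi K ℓ c 1 u := by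
      rw [← pow_succ, Nat.sub_add_cancel (Nat.one_le_pow _ _ hp.pos), h1, one_mul]
    exact mul_right_cancel this
  have hc : Nat.Coprime (ℓ ^ k) (ℓ ^ 2 - 1) := by
    apply Nat.Coprime.pow_left
    rw [hp.coprime_iff_not_dvd]
    intro hd
    have h4 : ℓ ∣ 1 := by
      have := (Nat.dvd_sub_iff_right (Nat.one_le_pow 2 ℓ hp.pos) (dvd_pow_self ℓ two_ne_zero)).1 hd
      exact this
    exact hp.one_lt.ne' (Nat.dvd_one.1 h4)
  have h5 : phi K ℓ c 1 u = 1 := by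
    have := pow_gcd_eq_one.2 ⟨h2, h3⟩
    rw [hc] at this
    exact (pow_one _).symm.trans this
  rw [Subgroup.mem_bot]
  exact Subtype.ext (hxu.trans h5)

theorem phi_succ_pow_eq_one {d : ℕ} (hd : 1 ≤ d) {u : quadOrder K (c * ℓ ^ 0)}
    (hu : IsCoprime u (ℓ : quadOrder K (c * ℓ ^ 0))) (h : phi K ℓ c d u = 1) :
    phi K ℓ c (d + 1) u ^ ℓ = 1 := by
  obtain ⟨e, a, ha, rfl⟩ := (phi_eq_one_iff d hu).1 h
  rw [← phi_pow _ hu, phi_eq_one_iff _ hu.pow_left]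
  exact ⟨e ^ ℓ, a ^ ℓ, ha.pow_prime Fact.out hd, by rw [mul_pow, Units.val_pow_eq_pow_val]⟩

/-- The same `u` represents a lift. Its class still has `ℓ`-power order because the kernel from `d +
1` to `d` is killed by `ℓ`, which needs `d ≥ 1`. -/
theorem kappaMap_surjective {d : ℕ} (hd : 1 ≤ d) : Function.Surjective (kappaMap K ℓ c d) := by
  intro x
  obtain ⟨u, hu, hxu⟩ := kappa_exists_phi x
  obtain ⟨k, hk⟩ := kappa_exists_pow_eq_one x
  have h1 : phi K ℓ c d (u ^ ℓ ^ k) = 1 := by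
    rw [phi_pow d hu, ← hxu]; exact congrArg (fun x => x.1.1) hk
  have h2 := phi_succ_pow_eq_one hd hu.pow_left h1
  rw [phi_pow _ hu, ← pow_mul, ← pow_succ] at h2
  obtain ⟨y, hy⟩ := exists_kappa (phi K ℓ c (d + 1) u) ((classMap_phi (Nat.zero_le _) hu).trans
    (phi_eq_one_of_level hu (level_zero ℓ u))) h2
  refine ⟨y, kappa_ext ?_⟩
  rw [kappaMap_val, hy, hxu]
  exact classMap_phi (Nat.le_succ d) hu

theorem phi_eq_one_iff_level {η : quadOrder K (c * ℓ ^ 0)} {T N : ℤ} (h : IsQuadBasis η T N)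
    (hD : T ^ 2 - 4 * N ≤ -3) {d : ℕ} (hd : 1 ≤ d) {u : quadOrder K (c * ℓ ^ 0)}
    (hu : IsCoprime u (ℓ : quadOrder K (c * ℓ ^ 0)))
    (hu1 : Level ℓ 1 u ∨ ∀ e : (quadOrder K (c * ℓ ^ 0))ˣ,
      (e : quadOrder K (c * ℓ ^ 0)) = 1 ∨ (e : quadOrder K (c * ℓ ^ 0)) = -1) :
    phi K ℓ c d u = 1 ↔ Level ℓ d u := by
  rw [phi_eq_one_iff d hu]
  exact h.exists_unit_mul_iff Fact.out hD hd hu hu1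

theorem isProUnit_of_level {C : Type*} [CommRing C] {p : ℕ} {u : C} (hu : IsCoprime u (p : C))
    (h : Level p 1 u) : IsProUnit p u :=
  ⟨hu, 0, by simpa using h⟩

/-- The kernel is generated by the class of `1 + ℓ^d (η - r)`, which has level exactly `d` and whose
`ℓ`-th power has level `d + 1`. The hypothesis `hd` ensures that no unit trivialises this class. -/
theorem card_ker_kappaMap {η : quadOrder K (c * ℓ ^ 0)} {T N : ℤ} (h : IsQuadBasis η T N)
    (hD : T ^ 2 - 4 * N ≤ -3) {d : ℕ}
    (hd : 1 ≤ d ∨ ∀ e : (quadOrder K (c * ℓ ^ 0))ˣ,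
      (e : quadOrder K (c * ℓ ^ 0)) = 1 ∨ (e : quadOrder K (c * ℓ ^ 0)) = -1)
    (r : ℤ) (hr : (ℓ : quadOrder K (c * ℓ ^ 0)) ^ (d + 1) ∣
      ((ℓ : quadOrder K (c * ℓ ^ 0)) ^ d * (η - (r : quadOrder K (c * ℓ ^ 0)))) ^ 2) :
    Nat.card (kappaMap K ℓ c d).ker = ℓ ∧
      Nonempty (Additive (kappaMap K ℓ c d).ker ≃+ ZMod ℓ) := by
  have hp : ℓ.Prime := Fact.out
  have hl2 := (dvd_pow_self _ (Nat.succ_ne_zero d)).trans hr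
  have hcop := isCoprime_one_add hl2
  have hlev : Level ℓ d _ := level_one_add (η := η) (r := r)
  have hlevl := level_one_add_pow hr
  have hlev' := h.not_level_one_add (d := d) hp r
  have hkey := fun a => h.exists_one_add_pow_mul_sub_dvd (a := a) hp hr
  clear hl2
  generalize (1 + (ℓ : quadOrder K (c * ℓ ^ 0)) ^ d * (η - (r : quadOrder K (c * ℓ ^ 0)))) = v at *
  have hpro : IsProUnit ℓ v := ⟨hcop, 1, by rw [pow_one]; exact hlevl.mono (by omega)⟩
  have hgker : kappaOf (d + 1) v hpro ∈ (kappaMap K ℓ c d).ker := by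
    rw [MonoidHom.mem_ker, kappaMap_kappaOf]
    apply kappa_ext
    rw [kappaOf_val]
    exact phi_eq_one_of_level hcop hlev
  refine nonempty_equiv_zmod_of_card hp (g := ⟨_, hgker⟩) (Subtype.ext ?_) ?_ ?_
  · change kappaOf (d + 1) v hpro ^ ℓ = 1
    rw [kappaOf_pow_eq_one_iff]
    exact phi_eq_one_of_level hcop.pow_left hlevl
  · intro h1
    have h2 : kappaOf (d + 1) v hpro ^ 1 = 1 := by
      rw [pow_one]; exact congrArg Subtype.val h1
    rw [kappaOf_pow_eq_one_iff, pow_one, phi_eq_one_iff_level h hD (Nat.succ_pos d) hcop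
      (hd.imp_left fun hd => hlev.mono hd)] at h2
    exact hlev' h2
  · rintro ⟨x, hx⟩
    obtain ⟨u, hu, hxu⟩ := kappa_exists_phi x
    have h1 : phi K ℓ c d u = 1 := by
      have h2 : (kappaMap K ℓ c d x).1.1 = 1 := congrArg (fun x => x.1.1) hx
      rw [kappaMap_val, hxu] at h2
      exact (classMap_phi (Nat.le_succ d) hu).symm.trans h2
    obtain ⟨e, a, ha, rfl⟩ := (phi_eq_one_iff d hu).1 h1
    have hacop : IsCoprime a (ℓ : quadOrder K (c * ℓ ^ 0)) := IsCoprime.of_mul_left_right hu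
    have hecop : IsCoprime (e : quadOrder K (c * ℓ ^ 0)) (ℓ : quadOrder K (c * ℓ ^ 0)) :=
      IsCoprime.of_mul_left_left hu
    have he1 : phi K ℓ c (d + 1) (e : quadOrder K (c * ℓ ^ 0)) = 1 :=
      (phi_eq_one_iff _ hecop).2 ⟨e, 1, level_one ℓ (d + 1), (mul_one _).symm⟩
    rw [phi_mul _ hecop hacop, he1, one_mul] at hxu
    obtain ⟨j, m, hm, hj⟩ := hkey a hacop ha
    have hmcop : IsCoprime (m : quadOrder K (c * ℓ ^ 0)) (ℓ : quadOrder K (c * ℓ ^ 0)) :=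
      isCoprime_intCast hp hm
    refine Subgroup.mem_zpowers_iff.2 ⟨j, Subtype.ext (kappa_ext ?_)⟩
    rw [zpow_natCast]
    change (kappaOf (d + 1) v hpro).1.1 ^ j = x.1.1
    rw [kappaOf_val, hxu, ← phi_pow _ hcop,
      ← phi_congr _ (hcop.pow_left.mul_left hmcop) hacop hj, phi_mul _ hcop.pow_left hmcop,
      phi_eq_one_of_level hmcop (level_intCast ℓ (d + 1) m), mul_one]

theorem card_kappa {η : quadOrder K (c * ℓ ^ 0)} {T N : ℤ} (h : IsQuadBasis η T N)
    (hD : T ^ 2 - 4 * N ≤ -3) (n : ℕ) :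
    Nat.card (kappa K ℓ c (n + 1)) = Nat.card (kappa K ℓ c 1) * ℓ ^ n := by
  induction n with
  | zero => simp
  | succ n ih =>
    -- In degree `n + 1 ≥ 1` the choice `r = 0` works, since `ℓ^(2(n+1))` is divisible by `ℓ^(n+2)`.
    have h1 := (card_ker_kappaMap h hD (d := n + 1) (Or.inl (by omega)) 0
      ⟨(ℓ : quadOrder K (c * ℓ ^ 0)) ^ n * η ^ 2, by rw [Int.cast_zero, sub_zero]; ring⟩).1
    have h2 := Subgroup.card_mul_index (kappaMap K ℓ c (n + 1)).ker
    rw [Subgroup.index_ker, MonoidHom.range_eq_top.2 (kappaMap_surjective (by omega)),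
      Subgroup.card_top, h1, ih] at h2
    rw [← h2]
    ring

theorem card_kappa_one {η : quadOrder K (c * ℓ ^ 0)} {T N : ℤ} (h : IsQuadBasis η T N)
    (hD : T ^ 2 - 4 * N ≤ -3)
    (hu : ∀ e : (quadOrder K (c * ℓ ^ 0))ˣ,
      (e : quadOrder K (c * ℓ ^ 0)) = 1 ∨ (e : quadOrder K (c * ℓ ^ 0)) = -1)
    (hram : (ℓ : ℤ) ∣ T ^ 2 - 4 * N) :
    Nat.card (kappa K ℓ c 1) = ℓ ∧ Nonempty (Additive (kappaMap K ℓ c 0).ker ≃+ ZMod ℓ) := by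
  obtain ⟨r, hr⟩ := h.exists_sq_dvd Fact.out hram
  obtain ⟨h1, h2⟩ := card_ker_kappaMap h hD (d := 0) (Or.inr hu) r
    (by
      obtain ⟨k, hk⟩ := hr
      exact ⟨k, by linear_combination hk⟩)
  refine ⟨?_, h2⟩
  have h3 : (kappaMap K ℓ c 0).ker = ⊤ := by
    rw [Subgroup.eq_top_iff']
    intro x
    exact Subtype.ext (Subgroup.mem_bot.1 (kappa_zero (K := K) (ℓ := ℓ) (c := c) ▸
      (kappaMap K ℓ c 0 x).2))
  rw [h3, Subgroup.card_top] at h1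
  exact h1

end Kappa

theorem exists_isQuadBasis_quadOrder (K : Type*) [Field K] [NumberField K]
    (hK : Module.finrank ℚ K = 2) (f : ℕ) [NeZero f] :
    ∃ (η : quadOrder K f) (T N : ℤ), IsQuadBasis η T N ∧ T ^ 2 - 4 * N = f ^ 2 * discr K := by
  obtain ⟨ω, t, n, h, hD⟩ := exists_isQuadBasis K hK
  have hf : (f : ℤ) ≠ 0 := by exact_mod_cast NeZero.ne f
  refine ⟨⟨f * ω, 0, ω, by simp⟩, f * t, f ^ 2 * n, ⟨?_, ?_, ?_⟩, by rw [hD]; ring⟩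
  · apply Subtype.ext
    push_cast
    linear_combination (f : 𝓞 K) ^ 2 * h.sq
  · rintro ⟨_, a, y, rfl⟩
    obtain ⟨p, q, rfl⟩ := h.span y
    exact ⟨a + f * p, q, Subtype.ext (by push_cast; ring)⟩
  · intro a b hab
    have := congrArg Subtype.val hab
    push_cast at this
    obtain ⟨h1, h2⟩ := h.indep a (b * f) (by push_cast; linear_combination this)
    exact ⟨h1, (mul_eq_zero.1 h2).resolve_right hf⟩

/-! ### Orders and independence of classes, read off from levels. -/

section Orders

variable {K : Type*} [Field K] {ℓ c : ℕ} [NumberField K] [Fact ℓ.Prime] [NeZero c]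
variable {η : quadOrder K (c * ℓ ^ 0)} {T N : ℤ}

theorem orderOf_kappaOf (h : IsQuadBasis η T N) (hD : T ^ 2 - 4 * N ≤ -3) {e j : ℕ}
    {u : quadOrder K (c * ℓ ^ 0)} (hu : IsProUnit ℓ u) (he : 1 ≤ e)
    (h2 : ℓ = 2 → 2 ≤ e ∨ Even T) (hl : Level ℓ e u) (hl' : ¬ Level ℓ (e + 1) u) {d : ℕ}
    (hd : d = e + j) : orderOf (kappaOf d u hu) = ℓ ^ j := by
  subst hd
  have hp : ℓ.Prime := Fact.out
  cases j with
  | zero =>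
    rw [pow_zero, orderOf_eq_one_iff]
    exact kappa_ext ((kappaOf_val _ hu).trans (phi_eq_one_of_level hu.1 hl))
  | succ j =>
    have h1 := h.level_pow_prime_pow hp hu.1 he h2 hl hl' j
    have h3 := h.level_pow_prime_pow hp hu.1 he h2 hl hl' (j + 1)
    apply orderOf_eq_prime_pow
    · rw [kappaOf_pow_eq_one_iff, phi_eq_one_iff_level h hD (by omega) hu.1.pow_left
        (Or.inl (h1.1.mono (by omega)))]
      exact h1.2
    · rw [kappaOf_pow_eq_one_iff]
      exact phi_eq_one_of_level hu.1.pow_left h3.1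

/-- Here `u` has level 0 and its `ℓ`-th power has level exactly 1, so the order is one factor `ℓ`
larger than for an element of level 1. -/
theorem orderOf_kappaOf_of_pow (h : IsQuadBasis η T N) (hD : T ^ 2 - 4 * N ≤ -3)
    (hunit : ∀ e : (quadOrder K (c * ℓ ^ 0))ˣ,
      (e : quadOrder K (c * ℓ ^ 0)) = 1 ∨ (e : quadOrder K (c * ℓ ^ 0)) = -1)
    {u : quadOrder K (c * ℓ ^ 0)} (hu : IsProUnit ℓ u)
    (h2 : ℓ = 2 → Even T) (hl : Level ℓ 1 (u ^ ℓ)) (hl' : ¬ Level ℓ 2 (u ^ ℓ)) (n : ℕ) :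
    orderOf (kappaOf (n + 1) u hu) = ℓ ^ (n + 1) := by
  have hp : ℓ.Prime := Fact.out
  have key := h.level_pow_prime_pow hp (u := u ^ ℓ) hu.1.pow_left le_rfl (fun h => Or.inr (h2 h))
    hl hl'
  apply orderOf_eq_prime_pow
  · rw [kappaOf_pow_eq_one_iff, phi_eq_one_iff_level h hD (by omega) hu.1.pow_left (Or.inr hunit)]
    -- For `n = 0` the element tested is `u` itself: were it of level 1, its `ℓ`-th power would have
    -- level 2.
    cases n with
    | zero =>
      intro h3
      have h4 : Level ℓ 1 u := (pow_one u) ▸ h3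
      exact hl' (h4.pow_prime hp le_rfl)
    | succ m =>
      have := (key m).2
      rw [← pow_mul, ← pow_succ', show 1 + m + 1 = m + 1 + 1 by omega] at this
      exact this
  · rw [kappaOf_pow_eq_one_iff]
    have := (key n).1
    rw [← pow_mul, ← pow_succ', show 1 + n = n + 1 by omega] at this
    exact phi_eq_one_of_level hu.1.pow_left this

/-- In `κ_s` the class of `v` dies and that of `w` has order `ℓ`, so `ℓ ∣ j`. Then the factor from
`w` is trivial in `κ_d`, and the order of `v` gives the other divisibility. -/
theorem kappaOf_indep (h : IsQuadBasis η T N) (hD : T ^ 2 - 4 * N ≤ -3) {s n d : ℕ}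
    (hs : 1 ≤ s) (hd : d = s + n) {v w : quadOrder K (c * ℓ ^ 0)} (hv : IsProUnit ℓ v)
    (hw : IsProUnit ℓ w) (h2 : ℓ = 2 → 2 ≤ s ∨ Even T) (hl : Level ℓ s v)
    (hl' : ¬ Level ℓ (s + 1) v) (hw1 : phi K ℓ c d (w ^ ℓ) = 1) (hw2 : phi K ℓ c s w ≠ 1)
    (i j : ℤ) (hij : kappaOf d v hv ^ i * kappaOf d w hw ^ j = 1) :
    (ℓ : ℤ) ^ n ∣ i ∧ (ℓ : ℤ) ∣ j := by
  have hsd : s ≤ d := by omega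
  have hvs : phi K ℓ c s v = 1 := phi_eq_one_of_level hv.1 hl
  have e1 : phi K ℓ c d v ^ i * phi K ℓ c d w ^ j = 1 := by
    rw [← kappaOf_val d hv, ← kappaOf_val d hw]
    exact congrArg (fun x => x.1.1) hij
  have e2 := congrArg (subringClassMap (quadOrder_le K (mul_dvd_mul_left c (pow_dvd_pow ℓ hsd)))) e1
  rw [map_mul, map_zpow, map_zpow, classMap_phi hsd hv.1, classMap_phi hsd hw.1, map_one, hvs,
    one_zpow, one_mul] at e2
  have hw1' : kappaOf d w hw ^ ℓ = 1 := (kappaOf_pow_eq_one_iff d hw ℓ).2 hw1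
  have e3 : phi K ℓ c s w ^ ℓ = 1 := by
    rw [← phi_pow s hw.1, ← classMap_phi hsd hw.1.pow_left, hw1, map_one]
  have hj : (ℓ : ℤ) ∣ j := by
    rw [← orderOf_eq_prime e3 hw2]
    exact orderOf_dvd_iff_zpow_eq_one.2 e2
  refine ⟨?_, hj⟩
  obtain ⟨k, rfl⟩ := hj
  rw [zpow_mul, zpow_natCast, hw1', one_zpow, mul_one, ← orderOf_dvd_iff_zpow_eq_one,
    orderOf_kappaOf h hD hv hs h2 hl hl' hd] at hij
  exact_mod_cast hij

end Orders

/-! ### Explicit elements with prescribed levels. -/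

section Elements

variable {C : Type*} [CommRing C] {η : C} {T N : ℤ}

theorem IsQuadBasis.one_add_pow_mul (h : IsQuadBasis η T N) {p e : ℕ} (hp : p.Prime) (he : 1 ≤ e) :
    IsProUnit p (1 + p ^ e * η) ∧ Level p e (1 + p ^ e * η) ∧ ¬ Level p (e + 1) (1 + p ^ e * η) := by
  have hl : Level p e (1 + p ^ e * η) := ⟨1, η, by push_cast; rfl⟩
  refine ⟨isProUnit_of_level ?_ (hl.mono he), hl, ?_⟩
  · obtain ⟨e, rfl⟩ := Nat.exists_eq_add_of_le' he
    exact ⟨1, -(p ^ e * η), by ring⟩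
  · simpa using h.not_level_one_add (d := e) hp 0

/-- The binomial expansion stops at the cubic term, because `s⁴ = D²` is divisible by `p²`. -/
theorem one_add_pow_eq_of_sq {p : ℕ} {D : ℤ} (hpD : (p : ℤ) ∣ D) {s : C} (hs : s * s = D) (n : ℕ) :
    ∃ z : C, (1 + s) ^ n =
      1 + n.choose 2 * D + (n + n.choose 3 * D : ℤ) * s + p ^ 2 * z := by
  obtain ⟨d, rfl⟩ := hpD
  induction n with
  | zero => exact ⟨0, by simp⟩
  | succ n ih =>
    obtain ⟨z, hz⟩ := ih
    refine ⟨n.choose 3 * d ^ 2 + z * (1 + s), ?_⟩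
    rw [pow_succ, hz, Nat.choose_succ_succ' n 1, Nat.choose_succ_succ' n 2, Nat.choose_one_right]
    push_cast
    push_cast at hs
    linear_combination (n + n.choose 3 * (p * d) : C) * hs

theorem IsQuadBasis.two_mul_sub_sq (h : IsQuadBasis η T N) :
    (2 * η - T) * (2 * η - T) = ((T ^ 2 - 4 * N : ℤ) : C) := by
  push_cast; linear_combination 4 * h.sq

theorem IsQuadBasis.sub_half_sq {T' : ℤ} (h : IsQuadBasis η (2 * T') N) :
    (η - T') * (η - T') = ((T' ^ 2 - N : ℤ) : C) := by
  have := h.sq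
  push_cast at this
  push_cast; linear_combination this

/-- Modulo `p²`, the coefficient of `√Δ` in `(1 + √Δ)^p` is `p + p.choose 3 * Δ`. For `p = 3` this
is `3 + Δ`, which separates the residues 3 and 6 modulo 9. -/
theorem IsQuadBasis.level_one_add_sqrt_pow (h : IsQuadBasis η T N) {p : ℕ} (hp : p.Prime)
    (hp2 : p ≠ 2) (hD : (p : ℤ) ∣ T ^ 2 - 4 * N)
    (hD2 : ¬ (p : ℤ) ^ 2 ∣ p + p.choose 3 * (T ^ 2 - 4 * N)) :
    IsProUnit p (1 + (2 * η - T)) ∧ Level p 1 ((1 + (2 * η - T)) ^ p) ∧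
      ¬ Level p 2 ((1 + (2 * η - T)) ^ p) := by
  obtain ⟨z, hz⟩ := one_add_pow_eq_of_sq hD h.two_mul_sub_sq p
  obtain ⟨x, y, rfl⟩ := h.span z
  set Δ := T ^ 2 - 4 * N
  set B := (p : ℤ) + p.choose 3 * Δ
  have e : (1 + (2 * η - T)) ^ p = ((1 + p.choose 2 * Δ - B * T + p ^ 2 * x : ℤ) : C) +
      ((2 * B + p ^ 2 * y : ℤ) : C) * η := by
    rw [hz]; push_cast; ring
  have hl : Level p 1 ((1 + (2 * η - T)) ^ p) := by
    rw [e, h.level_iff, pow_one]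
    refine dvd_add ((dvd_add dvd_rfl (hD.mul_left _)).mul_left _) ?_
    exact (dvd_pow_self _ two_ne_zero).mul_right _
  refine ⟨⟨isCoprime_one_add ?_, 1, by rwa [pow_one]⟩, hl, ?_⟩
  · rw [pow_two, h.two_mul_sub_sq]
    obtain ⟨k, hk⟩ := hD
    exact ⟨k, by rw [show T ^ 2 - 4 * N = p * k from hk]; push_cast; rfl⟩
  · rw [e, h.level_iff, dvd_add_left (dvd_mul_right _ _)]
    intro h3
    refine hD2 (IsCoprime.dvd_of_dvd_mul_left (IsCoprime.pow_left ?_) h3)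
    rw [show (2 : ℤ) = ((2 : ℕ) : ℤ) by rfl, Nat.isCoprime_iff_coprime]
    exact (Nat.coprime_primes hp Nat.prime_two).2 hp2

/-- Hensel's lemma for `1 + δX²` at 3: the derivative `2xδ` is 1 modulo 3, so the Newton correction
is `-3^(n+1) k`. -/
theorem exists_sq_mul_add_one_dvd {δ : ℤ} (hδ : δ % 3 = 2) (n : ℕ) :
    ∃ x : ℤ, x % 3 = 1 ∧ 3 ^ (n + 1) ∣ 1 + x ^ 2 * δ := by
  induction n with
  | zero => exact ⟨1, by norm_num, by rw [zero_add, pow_one, one_pow, one_mul]; omega⟩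
  | succ n ih =>
    obtain ⟨x, hx, k, hk⟩ := ih
    refine ⟨x - 3 ^ (n + 1) * k, ?_, ?_⟩
    · rw [pow_succ', mul_assoc, Int.sub_mul_emod_self_left, hx]
    · obtain ⟨q, h1⟩ : (3 : ℤ) ∣ 1 - 2 * x * δ := by
        obtain ⟨q, rfl⟩ : ∃ q, x = 3 * q + 1 := ⟨x / 3, by omega⟩
        obtain ⟨r, rfl⟩ : ∃ r, δ = 3 * r + 2 := ⟨δ / 3, by omega⟩
        exact ⟨-(6 * q * r + 4 * q + 2 * r + 1), by ring⟩
      refine ⟨k * q + 3 ^ n * k ^ 2 * δ, ?_⟩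
      have h3 : (3 : ℤ) ^ (n + 1) = 3 * 3 ^ n := by ring
      rw [pow_succ' 3 (n + 1)]
      linear_combination hk + 3 ^ (n + 1) * k * h1 + 3 ^ (n + 1) * k ^ 2 * δ * h3

/-- Uniqueness in Hensel's lemma, since `(x + y) δ` is prime to 3. It makes the successive
approximations compatible along the tower. -/
theorem sub_dvd_of_sq_mul_add_one_dvd {δ x y : ℤ} (hδ : δ % 3 = 2) (hx : x % 3 = 1)
    (hy : y % 3 = 1) {n : ℕ} (h1 : 3 ^ n ∣ 1 + x ^ 2 * δ) (h2 : 3 ^ n ∣ 1 + y ^ 2 * δ) :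
    3 ^ n ∣ x - y := by
  have h3 := dvd_sub h1 h2
  have e : 1 + x ^ 2 * δ - (1 + y ^ 2 * δ) = (x - y) * ((x + y) * δ) := by ring
  rw [e] at h3
  refine IsCoprime.dvd_of_dvd_mul_right (IsCoprime.pow_left ?_) h3
  rw [Int.prime_three.coprime_iff_not_dvd]
  intro h4
  rcases Int.prime_three.dvd_or_dvd h4 with h5 | h5 <;> omega

end Elements

section Elements

variable {C : Type*} [CommRing C] {η : C} {T N : ℤ}

/-- With `s = √(Δ/4)` and `s²` even, `(1 + s)² = 1 + s² + 2s` has `η`-coefficient exactly 2. -/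
theorem IsQuadBasis.level_one_add_half_sqrt_sq (h : IsQuadBasis η (2 * T) N)
    (hm : 2 ∣ T ^ 2 - N) :
    IsProUnit 2 (1 + (η - T)) ∧ Level 2 1 ((1 + (η - T)) ^ 2) ∧
      ¬ Level 2 2 ((1 + (η - T)) ^ 2) := by
  obtain ⟨k, hk⟩ := hm
  have hs := h.sub_half_sq
  rw [hk] at hs
  have e : (1 + (η - T)) ^ 2 = ((1 + 2 * k - 2 * T : ℤ) : C) + ((2 : ℤ) : C) * η := by
    push_cast at hs ⊢
    linear_combination hs
  have hl : Level 2 1 ((1 + (η - T)) ^ 2) := by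
    rw [e, h.level_iff]; norm_num
  refine ⟨⟨isCoprime_one_add ⟨k, ?_⟩, 1, by rwa [pow_one]⟩, hl, ?_⟩
  · rw [pow_two, hs]; push_cast; rfl
  · rw [e, h.level_iff]; norm_num

theorem IsQuadBasis.half_sqrt (h : IsQuadBasis η (2 * T) N) (hm : ¬ 2 ∣ T ^ 2 - N) :
    IsProUnit 2 (η - T) ∧ ¬ Level 2 1 (η - T) ∧ ∀ n, Level 2 n ((η - T) ^ 2) := by
  have hs : (η - T) ^ 2 = ((T ^ 2 - N : ℤ) : C) := by rw [pow_two, h.sub_half_sq]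
  have hl : ∀ n, Level 2 n ((η - T) ^ 2) := fun n => hs ▸ level_intCast 2 n _
  refine ⟨⟨(IsCoprime.pow_left_iff two_pos).1 ?_, 1, by rw [pow_one]; exact hl 1⟩, ?_, hl⟩
  · rw [hs]
    exact isCoprime_intCast Nat.prime_two (by exact_mod_cast hm)
  · have e : η - T = ((-T : ℤ) : C) + ((1 : ℤ) : C) * η := by push_cast; ring
    rw [e, h.level_iff]; norm_num

theorem IsQuadBasis.sqrt (h : IsQuadBasis η T N) (hD : ¬ 2 ∣ T ^ 2 - 4 * N) :
    IsProUnit 2 (2 * η - T) ∧ Level 2 1 (2 * η - T) ∧ ¬ Level 2 2 (2 * η - T) ∧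
      ∀ n, Level 2 n ((2 * η - T) ^ 2) := by
  have hs : (2 * η - T) ^ 2 = ((T ^ 2 - 4 * N : ℤ) : C) := by rw [pow_two, h.two_mul_sub_sq]
  have e : 2 * η - T = ((-T : ℤ) : C) + ((2 : ℤ) : C) * η := by push_cast; ring
  have hl : Level 2 1 (2 * η - T) := by rw [e, h.level_iff]; norm_num
  refine ⟨isProUnit_of_level ((IsCoprime.pow_left_iff two_pos).1 ?_) hl, hl, ?_,
    fun n => hs ▸ level_intCast 2 n _⟩
  · rw [hs]
    exact isCoprime_intCast Nat.prime_two (by exact_mod_cast hD)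
  · rw [e, h.level_iff]; norm_num

/-- With `s = √Δ`, the cube of `1 + xs` is `1 + 9x²δ + 3x(1 + x²δ)s`. As `x²δ` tends to `-1`, the
element tends to `1 + √-3`, a rational multiple of a sixth root of unity. -/
theorem IsQuadBasis.one_add_mul_sqrt (h : IsQuadBasis η T N) {δ x : ℤ}
    (hD : T ^ 2 - 4 * N = 3 * δ) (hx : x % 3 = 1) {n : ℕ} (hd : 3 ^ (n + 1) ∣ 1 + x ^ 2 * δ) :
    IsProUnit 3 (1 + x * (2 * η - T)) ∧ ¬ Level 3 1 (1 + x * (2 * η - T)) ∧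
      Level 3 (n + 1) ((1 + x * (2 * η - T)) ^ 3) := by
  have hs := h.two_mul_sub_sq
  rw [hD] at hs
  obtain ⟨k, hk⟩ := hd
  have e3 : (1 + x * (2 * η - T)) ^ 3 =
      ((1 + 9 * x ^ 2 * δ - 3 * x * (1 + x ^ 2 * δ) * T : ℤ) : C) +
      ((6 * x * (1 + x ^ 2 * δ) : ℤ) : C) * η := by
    push_cast at hs ⊢
    linear_combination (3 * x ^ 2 + x ^ 3 * (2 * η - T)) * hs
  have hl : Level 3 (n + 1) ((1 + x * (2 * η - T)) ^ 3) := by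
    rw [e3, h.level_iff, hk]
    exact ⟨6 * x * k, by push_cast; ring⟩
  refine ⟨⟨isCoprime_one_add ⟨x ^ 2 * δ, ?_⟩, 1, ?_⟩, ?_, hl⟩
  · push_cast at hs ⊢
    linear_combination x ^ 2 * hs
  · rw [pow_one]
    exact hl.mono (by omega)
  · have e : 1 + x * (2 * η - T) = ((1 - x * T : ℤ) : C) + ((2 * x : ℤ) : C) * η := by
      push_cast; ring
    rw [e, h.level_iff, pow_one]
    push_cast
    omega

end Elements

/-! ### The towers of isomorphisms in each case. -/

section Towers

variable {K : Type*} [Field K] {ℓ c : ℕ} [NumberField K] [Fact ℓ.Prime] [NeZero c]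
variable {η : quadOrder K (c * ℓ ^ 0)} {T N : ℤ}

theorem exists_equiv_of_not_dvd (h : IsQuadBasis η T N) (hD : T ^ 2 - 4 * N ≤ -3)
    (hℓ : ¬ (ℓ : ℤ) ∣ T ^ 2 - 4 * N) (h2 : ℓ ≠ 2) :
    ∃ e : ∀ n : ℕ, Additive (kappa K ℓ c (n + 1)) ≃+ ZMod (ℓ ^ n),
      ∀ (n : ℕ) (x : kappa K ℓ c (n + 2)),
        e n (Additive.ofMul (kappaMap K ℓ c (n + 1) x)) =
          canProj ℓ n (e (n + 1) (Additive.ofMul x)) := by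
  obtain ⟨hv, hl, hl'⟩ := h.one_add_pow_mul (p := ℓ) Fact.out le_rfl
  obtain ⟨e, he⟩ := exists_equiv_tower (G := fun n => kappa K ℓ c (n + 1))
    (fun n => kappaMap K ℓ c (n + 1)) (fun n => n) (fun n => kappaOf (n + 1) _ hv)
    (fun n => kappaMap_kappaOf (n + 1) hv)
    (fun n => by rw [card_kappa h hD n, kappa_one_eq_bot h hℓ, Subgroup.card_bot, one_mul])
    (fun n => orderOf_kappaOf h hD hv le_rfl (fun h => absurd h h2) hl hl' (Nat.add_comm n 1))
  exact ⟨e, fun n x => he n (pow_dvd_pow ℓ (Nat.le_succ _)) x⟩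

theorem exists_equiv_of_pow (h : IsQuadBasis η T N) (hD : T ^ 2 - 4 * N ≤ -3)
    (hunit : ∀ e : (quadOrder K (c * ℓ ^ 0))ˣ,
      (e : quadOrder K (c * ℓ ^ 0)) = 1 ∨ (e : quadOrder K (c * ℓ ^ 0)) = -1)
    (hℓ : (ℓ : ℤ) ∣ T ^ 2 - 4 * N) {u : quadOrder K (c * ℓ ^ 0)} (hu : IsProUnit ℓ u)
    (h2 : ℓ = 2 → Even T) (hl : Level ℓ 1 (u ^ ℓ)) (hl' : ¬ Level ℓ 2 (u ^ ℓ)) :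
    ∃ e : ∀ n : ℕ, Additive (kappa K ℓ c (n + 1)) ≃+ ZMod (ℓ ^ (n + 1)),
      ∀ (n : ℕ) (x : kappa K ℓ c (n + 2)),
        e n (Additive.ofMul (kappaMap K ℓ c (n + 1) x)) =
          canProj ℓ (n + 1) (e (n + 1) (Additive.ofMul x)) := by
  obtain ⟨e, he⟩ := exists_equiv_tower (G := fun n => kappa K ℓ c (n + 1))
    (fun n => kappaMap K ℓ c (n + 1)) (fun n => n + 1) (fun n => kappaOf (n + 1) _ hu)
    (fun n => kappaMap_kappaOf (n + 1) hu)
    (fun n => by rw [card_kappa h hD n, (card_kappa_one h hD hunit hℓ).1, pow_succ'])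
    (orderOf_kappaOf_of_pow h hD hunit hu h2 hl hl')
  exact ⟨e, fun n x => he n (pow_dvd_pow ℓ (Nat.le_succ _)) x⟩

/-- The second generator may vary with `n`: for `ℓ = 3` it is only known by approximation, and `hww`
makes its classes compatible. -/
theorem exists_equiv_prod_of_dvd (h : IsQuadBasis η T N) (hD : T ^ 2 - 4 * N ≤ -3)
    (hunit : ∀ e : (quadOrder K (c * ℓ ^ 0))ˣ,
      (e : quadOrder K (c * ℓ ^ 0)) = 1 ∨ (e : quadOrder K (c * ℓ ^ 0)) = -1)
    (hℓ : (ℓ : ℤ) ∣ T ^ 2 - 4 * N) (h2 : ℓ = 2 → Even T) (w : ℕ → quadOrder K (c * ℓ ^ 0))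
    (hw : ∀ n, IsProUnit ℓ (w n)) (hw' : ∀ n, ¬ Level ℓ 1 (w n))
    (hwℓ : ∀ n, Level ℓ (n + 1) (w n ^ ℓ))
    (hww : ∀ n, (ℓ : quadOrder K (c * ℓ ^ 0)) ^ (n + 1) ∣ w (n + 1) - w n) :
    ∃ e : ∀ n : ℕ, Additive (kappa K ℓ c (n + 1)) ≃+ ZMod (ℓ ^ n) × ZMod ℓ,
      ∀ (n : ℕ) (x : kappa K ℓ c (n + 2)),
        e n (Additive.ofMul (kappaMap K ℓ c (n + 1) x)) =
          Prod.map (canProj ℓ n) id (e (n + 1) (Additive.ofMul x)) := by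
  obtain ⟨hv, hl, hl'⟩ := h.one_add_pow_mul (p := ℓ) Fact.out le_rfl
  have hord := fun n => orderOf_kappaOf h hD hv le_rfl (fun h => Or.inr (h2 h)) hl hl'
    (Nat.add_comm n 1)
  have hw1 : ∀ n, phi K ℓ c (n + 1) (w n ^ ℓ) = 1 :=
    fun n => phi_eq_one_of_level (hw n).1.pow_left (hwℓ n)
  refine exists_equiv_tower_prod (G := fun n => kappa K ℓ c (n + 1))
    (fun n => kappaMap K ℓ c (n + 1)) (fun n => kappaOf (n + 1) _ hv)
    (fun n => kappaOf (n + 1) (w n) (hw n)) (fun n => kappaMap_kappaOf (n + 1) hv)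
    (fun n => ?_) (fun n => ?_) (fun n => ?_) (fun n => ?_) (fun n => ?_)
  · rw [kappaMap_kappaOf]
    apply kappa_ext
    rw [kappaOf_val, kappaOf_val]
    exact phi_congr _ (hw (n + 1)).1 (hw n).1 (hww n)
  · rw [card_kappa h hD n, (card_kappa_one h hD hunit hℓ).1, pow_succ']
  · exact hord n ▸ pow_orderOf_eq_one _
  · exact (kappaOf_pow_eq_one_iff _ (hw n) ℓ).2 (hw1 n)
  · refine kappaOf_indep h hD le_rfl (Nat.add_comm n 1) hv (hw n) (fun h => Or.inr (h2 h)) hl hl'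
      (hw1 n) ?_
    rw [Ne, phi_eq_one_iff_level h hD le_rfl (hw n).1 (Or.inr hunit)]
    exact hw' n

end Towers

/-- As `T` is odd, squaring raises levels by exactly one only from level 2 on. Hence the cyclic
factor is generated by `1 + 4η`, and `√Δ`, of level exactly 1 with integral square, gives the other.
-/
theorem exists_equiv_prod_of_odd {K : Type*} [Field K] {c : ℕ} [NumberField K] [NeZero c]
    {η : quadOrder K (c * 2 ^ 0)} {T N : ℤ} (h : IsQuadBasis η T N) (hD : T ^ 2 - 4 * N ≤ -3)
    (h2 : ¬ 2 ∣ T ^ 2 - 4 * N) :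
    ∃ e : ∀ n : ℕ, Additive (kappa K 2 c (n + 2)) ≃+ ZMod (2 ^ n) × ZMod 2,
      ∀ (n : ℕ) (x : kappa K 2 c (n + 3)),
        e n (Additive.ofMul (kappaMap K 2 c (n + 2) x)) =
          Prod.map (canProj 2 n) id (e (n + 1) (Additive.ofMul x)) := by
  obtain ⟨hv, hl, hl'⟩ := h.one_add_pow_mul Nat.prime_two one_le_two
  obtain ⟨hw, hwl, hwl', hw2⟩ := h.sqrt h2
  have hord := fun n => orderOf_kappaOf h hD hv one_le_two (fun _ => Or.inl le_rfl) hl hl'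
    (Nat.add_comm n 2)
  have hw1 : ∀ n, phi K 2 c n ((2 * η - (T : quadOrder K (c * 2 ^ 0))) ^ 2) = 1 :=
    fun n => phi_eq_one_of_level hw.1.pow_left (hw2 n)
  refine exists_equiv_tower_prod (G := fun n => kappa K 2 c (n + 2))
    (fun n => kappaMap K 2 c (n + 2)) (fun n => kappaOf (n + 2) _ hv)
    (fun n => kappaOf (n + 2) _ hw) (fun n => kappaMap_kappaOf (n + 2) hv)
    (fun n => kappaMap_kappaOf (n + 2) hw) (fun n => ?_) (fun n => ?_) (fun n => ?_) (fun n => ?_)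
  · rw [card_kappa h hD (n + 1), kappa_one_eq_bot h (by exact_mod_cast h2), Subgroup.card_bot,
      one_mul]
  · exact hord n ▸ pow_orderOf_eq_one _
  · exact (kappaOf_pow_eq_one_iff _ hw 2).2 (hw1 _)
  · refine kappaOf_indep h hD one_le_two (Nat.add_comm n 2) hv hw (fun _ => Or.inl le_rfl) hl hl'
      (hw1 _) ?_
    rw [Ne, phi_eq_one_iff_level h hD one_le_two hw.1 (Or.inl hwl)]
    exact hwl'

theorem Int.sq_emod_three_of_not_dvd {a : ℤ} (h : ¬ 3 ∣ a) : a ^ 2 % 3 = 1 := by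
  have : a % 3 = 1 ∨ a % 3 = 2 := by omega
  rcases this with h | h <;> simp [pow_two, Int.mul_emod, h]

end

/-! ### Assembly of the cases. -/

theorem mainTheorem7 (K : Type*) [Field K] [NumberField K]
    (hK : Module.finrank ℚ K = 2) [IsTotallyComplex K]
    (ℓ : ℕ) (hℓ : ℓ.Prime) (c : ℕ) (hc : 1 ≤ c) (hcℓ : c.Coprime ℓ) :
    -- the case `d = 0`
    (kappa K ℓ c 0 = ⊥ ∧ ∀ x, kappaMap K ℓ c 0 x = 1) ∧
    -- `ℓ ≥ 3` split or inert: `κ_d ≅ ℤ/ℓ^(d-1)` for `d = n + 1 ≥ 1`, with `π'_d = can`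
    (3 ≤ ℓ → (SplitIn K ℓ ∨ InertIn K ℓ) →
      ∃ e : ∀ n : ℕ, Additive (kappa K ℓ c (n + 1)) ≃+ ZMod (ℓ ^ n),
        ∀ (n : ℕ) (x : kappa K ℓ c (n + 2)),
          e n (Additive.ofMul (kappaMap K ℓ c (n + 1) x)) =
            canProj ℓ n (e (n + 1) (Additive.ofMul x))) ∧
    -- `ℓ` ramified, general case: `κ_d ≅ ℤ/ℓ^d` for `d = n + 1 ≥ 1`, with `π'_d = can`
    (RamifiedIn K ℓ →
      ((ℓ = 2 ∧ discr K ≡ 8 [ZMOD 16]) ∨ (ℓ = 3 ∧ discr K ≡ 3 [ZMOD 9]) ∨ 5 ≤ ℓ) →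
      ∃ e : ∀ n : ℕ, Additive (kappa K ℓ c (n + 1)) ≃+ ZMod (ℓ ^ (n + 1)),
        ∀ (n : ℕ) (x : kappa K ℓ c (n + 2)),
          e n (Additive.ofMul (kappaMap K ℓ c (n + 1) x)) =
            canProj ℓ (n + 1) (e (n + 1) (Additive.ofMul x))) ∧
    -- `ℓ` ramified, special case: `κ_d ≅ ℤ/ℓ^(d-1) × ℤ/ℓ` for `d = n + 1 ≥ 1`,
    -- with `π'_d = can × id`
    (RamifiedIn K ℓ →
      ((ℓ = 2 ∧ discr K ≡ 12 [ZMOD 16]) ∨ (ℓ = 3 ∧ discr K ≡ 6 [ZMOD 9])) →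
      ¬ (c = 1 ∧ ((ℓ = 2 ∧ discr K = -4) ∨ (ℓ = 3 ∧ discr K = -3))) →
      ∃ e : ∀ n : ℕ, Additive (kappa K ℓ c (n + 1)) ≃+ ZMod (ℓ ^ n) × ZMod ℓ,
        ∀ (n : ℕ) (x : kappa K ℓ c (n + 2)),
          e n (Additive.ofMul (kappaMap K ℓ c (n + 1) x)) =
            Prod.map (canProj ℓ n) id (e (n + 1) (Additive.ofMul x))) ∧
    -- `ℓ = 2` split or inert: `κ_1 = 0`, and `κ_d ≅ ℤ/2^(d-2) × ℤ/2` for `d = n + 2 ≥ 2`,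
    -- with `π'_d = can × id`
    (ℓ = 2 → (SplitIn K ℓ ∨ InertIn K ℓ) →
      kappa K ℓ c 1 = ⊥ ∧
      ∃ e : ∀ n : ℕ, Additive (kappa K ℓ c (n + 2)) ≃+ ZMod (2 ^ n) × ZMod 2,
        ∀ (n : ℕ) (x : kappa K ℓ c (n + 3)),
          e n (Additive.ofMul (kappaMap K ℓ c (n + 2) x)) =
            Prod.map (canProj 2 n) id (e (n + 1) (Additive.ofMul x))) ∧
    -- the kernels of the transition maps
    (RamifiedIn K ℓ →
      ¬ (c = 1 ∧ ((ℓ = 2 ∧ discr K = -4) ∨ (ℓ = 3 ∧ discr K = -3))) →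
      Nonempty (Additive (kappaMap K ℓ c 0).ker ≃+ ZMod ℓ)) ∧
    (¬ RamifiedIn K ℓ → (kappaMap K ℓ c 0).ker = ⊥) ∧
    (∀ d : ℕ, 1 ≤ d → Nonempty (Additive (kappaMap K ℓ c d).ker ≃+ ZMod ℓ)) := by
  have hF : Fact ℓ.Prime := ⟨hℓ⟩
  have hc0 : NeZero c := ⟨by omega⟩
  have hf0 : NeZero (c * ℓ ^ 0) := ⟨mul_ne_zero hc0.out (pow_ne_zero 0 hℓ.ne_zero)⟩
  obtain ⟨η, T, N, h, hΔ⟩ := exists_isQuadBasis_quadOrder K hK (c * ℓ ^ 0)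
  rw [show ((c * ℓ ^ 0 : ℕ) : ℤ) = c by simp] at hΔ
  have hdisc := discr_le_neg_three K hK
  have hc2 : (1 : ℤ) ≤ (c : ℤ) ^ 2 := one_le_pow₀ (by exact_mod_cast hc)
  have hD : T ^ 2 - 4 * N ≤ -3 := by rw [hΔ]; nlinarith
  have hpi : Prime (ℓ : ℤ) := Nat.prime_iff_prime_int.1 hℓ
  have hcℓ' : ¬ (ℓ : ℤ) ∣ c := fun h1 =>
    (hℓ.coprime_iff_not_dvd.1 hcℓ.symm) (Int.natCast_dvd_natCast.1 h1)
  have hram : RamifiedIn K ℓ ↔ (ℓ : ℤ) ∣ T ^ 2 - 4 * N := by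
    rw [ramifiedIn_iff hK hℓ, hΔ]
    exact ⟨fun h1 => h1.mul_left _,
      fun h1 => (hpi.dvd_or_dvd h1).resolve_left fun h2 => hcℓ' (hpi.dvd_of_dvd_pow h2)⟩
  have hunr : SplitIn K ℓ ∨ InertIn K ℓ → ¬ (ℓ : ℤ) ∣ T ^ 2 - 4 * N := fun h1 => hram.not.1
    (h1.elim (not_ramifiedIn_of_splitIn hℓ) (not_ramifiedIn_of_inertIn hℓ))
  have hunit : RamifiedIn K ℓ →
      ¬ (c = 1 ∧ ((ℓ = 2 ∧ discr K = -4) ∨ (ℓ = 3 ∧ discr K = -3))) →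
      ∀ e : (quadOrder K (c * ℓ ^ 0))ˣ,
        (e : quadOrder K (c * ℓ ^ 0)) = 1 ∨ (e : quadOrder K (c * ℓ ^ 0)) = -1 := by
    intro h1 h2
    rw [ramifiedIn_iff hK hℓ] at h1
    -- For `c ≥ 2` one has `Δ = c² D ≤ -12`, so further units can occur only for `c = 1`.
    have hc1 : -4 ≤ T ^ 2 - 4 * N → c = 1 := by
      rw [hΔ]
      intro h3
      by_contra h4
      have h5 : (2 : ℤ) ≤ c := by omega
      nlinarith
    refine h.unit_eq_of_discr hD (fun h3 => h2 ?_) (fun h3 => h2 ?_)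
    · obtain rfl := hc1 (by omega)
      rw [Nat.cast_one, one_pow, one_mul, h3] at hΔ
      rw [← hΔ, dvd_neg] at h1
      exact ⟨rfl, Or.inr ⟨(Nat.prime_dvd_prime_iff_eq hℓ Nat.prime_three).1
        (by exact_mod_cast h1), hΔ.symm⟩⟩
    · obtain rfl := hc1 (by omega)
      rw [Nat.cast_one, one_pow, one_mul, h3] at hΔ
      rw [← hΔ, dvd_neg, show (4 : ℤ) = ((2 ^ 2 : ℕ) : ℤ) by norm_num,
        Int.natCast_dvd_natCast] at h1
      exact ⟨rfl, Or.inl ⟨(Nat.prime_dvd_prime_iff_eq hℓ Nat.prime_two).1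
        (hℓ.dvd_of_dvd_pow h1), hΔ.symm⟩⟩
  have hbot : kappa K ℓ c 0 = ⊥ := kappa_zero
  have hmap : ∀ x, kappaMap K ℓ c 0 x = 1 := fun x =>
    Subtype.ext (Subgroup.mem_bot.1 (hbot ▸ (kappaMap K ℓ c 0 x).2))
  refine ⟨⟨hbot, hmap⟩, ?_, ?_, ?_, ?_, ?_, ?_, ?_⟩
  · intro h3 h1
    exact exists_equiv_of_not_dvd h hD (hunr h1) (by omega)
  · intro hr hcase
    -- The discriminants `-4 ≡ 12` modulo 16 and `-3 ≡ 6` modulo 9 fall outside this case.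
    have hu := hunit hr (by
      rw [Int.ModEq, Int.ModEq] at hcase
      omega)
    have hdvd := hram.1 hr
    by_cases h2 : ℓ = 2
    · subst h2
      have h8 : (T ^ 2 - 4 * N) % 8 = 0 := by
        have h1 : discr K % 16 = 8 := by
          rcases hcase with ⟨-, h1⟩ | ⟨h1, -⟩ | h1
          · exact h1
          · omega
          · omega
        rw [hΔ]
        exact Int.emod_eq_zero_of_dvd ((show (8 : ℤ) ∣ discr K by omega).mul_left _)
      have hT : Even T := by
        have h1 : Even (T ^ 2) := by rw [Int.even_iff]; omega
        exact (Int.even_pow.1 h1).1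
      obtain ⟨T, rfl⟩ := hT.two_dvd
      obtain ⟨hw, hl, hl'⟩ := h.level_one_add_half_sqrt_sq (by
        rw [mul_pow] at h8; omega)
      exact exists_equiv_of_pow h hD hu hdvd hw (fun _ => hT) hl hl'
    · obtain ⟨hw, hl, hl'⟩ := h.level_one_add_sqrt_pow hℓ h2 hdvd (by
        by_cases h3 : ℓ = 3
        · subst h3
          have h1 : discr K % 9 = 3 := by
            rcases hcase with ⟨h1, -⟩ | ⟨-, h1⟩ | h1
            · omega
            · exact h1
            · omega
          have h4 := Int.sq_emod_three_of_not_dvd (a := c) (by exact_mod_cast hcℓ')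
          rw [hΔ]
          obtain ⟨q, hq⟩ : ∃ q, discr K = 9 * q + 3 := ⟨discr K / 9, by omega⟩
          obtain ⟨r, hr⟩ : ∃ r, (c : ℤ) ^ 2 = 3 * r + 1 := ⟨(c : ℤ) ^ 2 / 3, by omega⟩
          rw [hq, hr, Nat.choose_self, show ((3 : ℕ) : ℤ) ^ 2 = 9 by norm_num,
            show ((3 : ℕ) : ℤ) + ((1 : ℕ) : ℤ) * ((3 * r + 1) * (9 * q + 3)) =
              9 * (3 * r * q + r + q) + 6 by push_cast; ring]
          omega
        · have h5 : 3 < ℓ := by have := hℓ.two_le; omega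
          have h6 : (ℓ : ℤ) ∣ ℓ.choose 3 :=
            Int.natCast_dvd_natCast.2 (hℓ.dvd_choose_self three_ne_zero h5)
          -- For `ℓ ≥ 5` both `ℓ.choose 3` and `Δ` are divisible by `ℓ`, so only the term `ℓ`
          -- matters modulo `ℓ²`.
          rw [dvd_add_left (by rw [pow_two]; exact mul_dvd_mul h6 hdvd)]
          intro h7
          have h8 : ℓ ^ 2 ∣ ℓ ^ 1 := by rw [pow_one]; exact_mod_cast h7
          have := (Nat.pow_dvd_pow_iff_le_right hℓ.one_lt).1 h8
          omega)
      exact exists_equiv_of_pow h hD hu hdvd hw (fun h1 => absurd h1 h2) hl hl'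
  · intro hr hcase hexc
    have hu := hunit hr hexc
    have hdvd := hram.1 hr
    rcases hcase with ⟨rfl, h1⟩ | ⟨rfl, h1⟩
    · have h8 : (T ^ 2 - 4 * N) % 8 = 4 := by
        have h1' : discr K % 16 = 12 := h1
        have h2 : (c : ℤ) % 2 = 1 := by
          have : ¬ (2 : ℤ) ∣ c := by exact_mod_cast hcℓ'
          omega
        obtain ⟨r, hr⟩ : ∃ r, (c : ℤ) = 2 * r + 1 := ⟨(c : ℤ) / 2, by omega⟩
        obtain ⟨q, hq⟩ : ∃ q, discr K = 8 * q + 4 := ⟨discr K / 8, by omega⟩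
        rw [hΔ, hq, hr, show (2 * r + 1) ^ 2 * (8 * q + 4) =
          8 * (4 * r ^ 2 * q + 4 * r * q + q + 2 * r ^ 2 + 2 * r) + 4 by ring]
        omega
      have hT : Even T := by
        have h1 : Even (T ^ 2) := by rw [Int.even_iff]; omega
        exact (Int.even_pow.1 h1).1
      obtain ⟨T, rfl⟩ := hT.two_dvd
      obtain ⟨hw, hw', hl⟩ := h.half_sqrt (by rw [mul_pow] at h8; omega)
      exact exists_equiv_prod_of_dvd h hD hu hdvd (fun _ => hT) (fun _ => _) (fun _ => hw)
        (fun _ => hw') (fun n => hl (n + 1)) (fun n => by rw [sub_self]; exact dvd_zero _)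
    · have h1' : discr K % 9 = 6 := h1
      have h4 := Int.sq_emod_three_of_not_dvd (a := c) (by exact_mod_cast hcℓ')
      -- As `c² ≡ 1` modulo 3, `Δ ≡ 6` modulo 9, so `-δ ≡ 1` modulo 3 is a 3-adic square.
      obtain ⟨δ, hδ, hδ'⟩ : ∃ δ, T ^ 2 - 4 * N = 3 * δ ∧ δ % 3 = 2 := by
        obtain ⟨q, hq⟩ : ∃ q, discr K = 9 * q + 6 := ⟨discr K / 9, by omega⟩
        obtain ⟨r, hr⟩ : ∃ r, (c : ℤ) ^ 2 = 3 * r + 1 := ⟨(c : ℤ) ^ 2 / 3, by omega⟩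
        refine ⟨3 * (3 * r * q + 2 * r + q) + 2, ?_, by omega⟩
        rw [hΔ, hq, hr]; ring
      choose x hx hxd using exists_sq_mul_add_one_dvd hδ'
      have hw := fun n => h.one_add_mul_sqrt hδ (hx n) (hxd n)
      refine exists_equiv_prod_of_dvd h hD hu hdvd (fun h => absurd h (by norm_num)) _
        (fun n => (hw n).1) (fun n => (hw n).2.1) (fun n => (hw n).2.2) (fun n => ?_)
      obtain ⟨k, hk⟩ := sub_dvd_of_sq_mul_add_one_dvd hδ' (hx (n + 1)) (hx n)
        ((pow_dvd_pow 3 (Nat.le_succ (n + 1))).trans (hxd (n + 1))) (hxd n)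
      have hk' := congrArg (Int.cast (R := quadOrder K (c * 3 ^ 0))) hk
      push_cast at hk' ⊢
      exact ⟨k * (2 * η - T), by linear_combination (2 * η - T) * hk'⟩
  · rintro rfl h1
    have h2 := hunr h1
    exact ⟨kappa_one_eq_bot h h2, exists_equiv_prod_of_odd h hD (by exact_mod_cast h2)⟩
  · intro hr hexc
    exact (card_kappa_one h hD (hunit hr hexc) (hram.1 hr)).2
  · intro hr
    rw [eq_bot_iff]
    intro x _
    rw [Subgroup.mem_bot]
    exact Subtype.ext (Subgroup.mem_bot.1
      (kappa_one_eq_bot (K := K) (ℓ := ℓ) (c := c) h (hram.not.1 hr) ▸ x.2))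
  · intro d hd
    obtain ⟨d, rfl⟩ := Nat.exists_eq_add_of_le' hd
    exact (card_ker_kappaMap h hD (Or.inl hd) 0
      ⟨(ℓ : quadOrder K (c * ℓ ^ 0)) ^ d * η ^ 2, by rw [Int.cast_zero, sub_zero]; ring⟩).2
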